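/- Let $X$ be a Euclidean space (a finite-dimensional real inner product space), and for $\rho\ge 0$ let $B(w;\rho)$ be the closed ball of centre $w$ and radius $\rho$. For nonempty $C\subseteq X$ put $d_C(x)=\inf_{c\in C}\|x-c\|$, $P_Cx=\{c\in C:\|x-c\|=d_C(x)\}$, and $P_C^\lambda x=\{(1-\lambda)x+\lambda p: p\in P_Cx\}$. For $x\in C$ let $N^{\rm prox}_C(x)=\{c(z-x): z\in X,\ x\in P_Cz,\ c\ge 0\}$, and let $N_C(x)$ be the set of all limits $u=\lim u_n$ with $u_n\in N^{\rm prox}_C(x_n)$, $x_n\in C$, $x_n\to x$. *Regularity notions.* $C$ is superregular at $w$ if for every $\varepsilon>0$ there is $\delta>0$ such that $\langle u,x-y\rangle\ge-\varepsilon\|u\|\,\|x-y\|$ for all $x,y\in C\cap B(w;\delta)$ and $u\in N^{\rm prox}_C(x)$. A finite family $\{D_i\}$ of sets is linearly regular around $w$ if there are $\delta,\kappa>0$ with $d_{\bigcap_i D_i}(x)\le\kappa\max_i d_{D_i}(x)$ for all $x\in B(w;\delta)$. It is affine-hull regular at $w\in\bigcap_i D_i$ if, with $L=\operatorname{aff}\bigcup_i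 D_i$, the conditions $u_i\in N_{D_i}(w)\cap(L-w)$ for all $i$ and $\sum_i u_i=0$ imply $u_i=0$ for all $i$. *Algorithm.* Let $I=\{1,\dots,m\}$, $J=\{1,\dots,\ell\}$ with $m,\ell\ge1$, and let $C_i$ $(i\in I)$ be closed, possibly nonconvex, subsets of $X$ with $C:=\bigcap_{i\in I}C_i\ne\varnothing$. For $j\in J$ let $\lambda_j,\mu_j\in\,]0,2]$, let $\widehat\beta_j=\big(\frac{\lambda_j}{2-\lambda_j}+\frac{\mu_j}{2-\mu_j}\big)^{-1}$ (with $\widehat\beta_j=0$ if $\lambda_j=2$ or $\mu_j=2$), let $\alpha_j\in\,]0,1+\widehat\beta_j[$, and let $s_j\ne t_j$ in $I$ be such that $\{s_j\}_{j\in J}\cup\{t_j\}_{j\in J}=I$. Define the set-valued operators $T_j=(1-\alpha_j)\operatorname{Id}+\alpha_jP_{C_{t_j}}^{\mu_j}P_{C_{s_j}}^{\lambda_j}$ and let $\operatorname{Fix}T_j=\{x: x\in T_jx\}$. The cyclic generalized DR algorithm generates cyclic sequences, i.e. sequences $(x_n)_{n\ge0}$ with $x_{n+1}\in T_{n+1}x_n$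 for all $n\ge 0$, where $T_{\ell n+j}:=T_j$ for $n\ge0$, $j\in J$. It is connected if the undirected graph with vertex set $I$ and edges $\{s_j,t_j\}$, $j\in J$, is connected. With $L_j=\operatorname{aff}(C_{s_j}\cup C_{t_j})$ put $Z_j=(C_{s_j}\cap C_{t_j})+(L_j-L_j)^\perp$ if $\lambda_j=\mu_j=2$, and $Z_j=C_{s_j}\cap C_{t_j}$ otherwise. **Theorem.** Let $w\in C$. Suppose that $\{Z_j\}_{j\in J}$ is linearly regular around $w$, that every $C_i$ is superregular at $w$, and that for every $j\in J$ the pair $\{C_{s_j},C_{t_j}\}$ is linearly regular around $w$ if $\min\{\lambda_j,\mu_j\}<2$ and affine-hull regular at $w$ otherwise. Then $\bigcap_{j\in J}Z_j\subseteq\bigcap_{j\in J}\operatorname{Fix}T_j$, and there are $\delta>0$ and $\rho\in[0,1[$ such that every cyclic sequence $(x_n)$ with $x_0\in B(w;\delta)$ converges $R$-linearly with rate $\rho$ to some $\overline x\in\bigcap_{j\in J}Z_j$, that is, there is $\sigma\ge0$ with $\|x_n-\overline x\|\le\sigma\rho^n$ for all $n\ge 0$. Moreover, if the algorithm is connected,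 then $P_{C_1}\overline x=\cdots=P_{C_m}\overline x$ is a single point, and this point belongs to $C$. -/

import Mathlib

open Set Filter Topology
open scoped Pointwise

namespace CyclicGDR

noncomputable section

section Sets

variable {X : Type*} [NormedAddCommGroup X] [InnerProductSpace ℝ X]

/-- The set-valued projector `P_C x`: all nearest points of `C` to `x`. -/
def projector (C : Set X) (x : X) : Set X :=
  {c | c ∈ C ∧ ‖x - c‖ = Metric.infDist x C}

/-- The relaxed projector `P_C^lam = (1 - lam) Id + lam P_C` (set-valued). -/
def relaxedProjector (C : Set X) (lam : ℝ) (x : X) : Set X :=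
  {r | ∃ p ∈ projector C x, r = (1 - lam) • x + lam • p}

/-- The generalized Douglas-Rachford operator
`(1 - al) Id + al P_B^mu P_A^lam` for the pair `(A, B)` (set-valued). -/
def gdrOperator (A B : Set X) (lam mu al : ℝ) (x : X) : Set X :=
  {y | ∃ r ∈ relaxedProjector A lam x, ∃ s ∈ relaxedProjector B mu r,
    y = (1 - al) • x + al • s}

/-- Fixed points of a set-valued operator. -/
def fixedPoints (T : X → Set X) : Set X :=
  {x | x ∈ T x}

/-- The proximal normal cone to `C` at a point `x` of `C`. -/
def proximalNormalCone (C : Set X) (x : X) : Set X :=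
  {u | ∃ z : X, x ∈ projector C z ∧ ∃ c : ℝ, 0 ≤ c ∧ u = c • (z - x)}

/-- The limiting normal cone to `C` at `x`. -/
def limitingNormalCone (C : Set X) (x : X) : Set X :=
  {u | ∃ (xs us : ℕ → X), (∀ n, xs n ∈ C) ∧ (∀ n, us n ∈ proximalNormalCone C (xs n)) ∧
    Tendsto xs atTop (𝓝 x) ∧ Tendsto us atTop (𝓝 u)}

/-- `C` is `(ε, δ)`-regular at `w`. -/
def IsRegularAt (C : Set X) (ε δ : ℝ) (w : X) : Prop :=
  ∀ x ∈ C ∩ Metric.closedBall w δ, ∀ y ∈ C ∩ Metric.closedBall w δ,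
    ∀ u ∈ proximalNormalCone C x, -(ε * (‖u‖ * ‖x - y‖)) ≤ inner ℝ u (x - y)

/-- `C` is superregular at `w`. -/
def IsSuperregularAt (C : Set X) (w : X) : Prop :=
  ∀ ε > 0, ∃ δ > 0, IsRegularAt C ε δ w

/-- A finite system of sets is `κ`-linearly regular on `U`. -/
def IsLinearlyRegularOn {ι : Type*} [Fintype ι] (C : ι → Set X) (κ : ℝ) (U : Set X) : Prop :=
  ∀ x ∈ U, Metric.infDist x (⋂ i, C i) ≤ κ * ⨆ i, Metric.infDist x (C i)

/-- A finite system of sets is linearly regular around `w`. -/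
def IsLinearlyRegularAround {ι : Type*} [Fintype ι] (C : ι → Set X) (w : X) : Prop :=
  ∃ δ > 0, ∃ κ > 0, IsLinearlyRegularOn C κ (Metric.closedBall w δ)

/-- A finite system of sets is `L`-regular at `w` (for `w` in all the sets and in `L`);
`u i + w ∈ L` says `u i ∈ L - w`. -/
def IsLRegularAt {ι : Type*} [Fintype ι] (C : ι → Set X) (L : AffineSubspace ℝ X) (w : X) :
    Prop :=
  ∀ u : ι → X, ∑ i, u i = 0 → (∀ i, u i ∈ limitingNormalCone (C i) w ∧ u i + w ∈ L) →
    ∀ i, u i = 0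

/-- A finite system of sets is affine-hull regular at `w`. -/
def IsAffineHullRegularAt {ι : Type*} [Fintype ι] (C : ι → Set X) (w : X) : Prop :=
  IsLRegularAt C (affineSpan ℝ (⋃ i, C i)) w

open Classical in
/-- The set `Z` attached to a pair `(A, B)` with parameters `lam`, `mu`. With
`L = aff (A ∪ B)`, the direction of `L` is `L - L`. -/
def gdrSet (A B : Set X) (lam mu : ℝ) : Set X :=
  if lam = 2 ∧ mu = 2 then
    (A ∩ B) + (((affineSpan ℝ (A ∪ B)).directionᗮ : Submodule ℝ X) : Set X)
  else A ∩ B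

/-- `x` is a cyclic sequence generated by `(T_0, ..., T_{l-1})`: the operators are applied in
this order, over and over again. -/
def IsCyclicSequence {l : ℕ} (T : Fin l → X → Set X) (x : ℕ → X) : Prop :=
  ∀ (n : ℕ) (j : Fin l), x (l * n + j + 1) ∈ T j (x (l * n + j))

/-- `x` converges to `a` with `R`-linear rate `ρ` (used with `0 ≤ ρ < 1`). -/
def ConvergesRLinearly (x : ℕ → X) (a : X) (ρ : ℝ) : Prop :=
  ∃ σ : ℝ, 0 ≤ σ ∧ ∀ n, ‖x n - a‖ ≤ σ * ρ ^ n

end Sets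

open Classical in
/-- `(lam / (2 - lam) + mu / (2 - mu))⁻¹`, equal to `0` when `lam = 2` or `mu = 2`
(one of the summands is then infinite). -/
def betaHat (lam mu : ℝ) : ℝ :=
  if lam = 2 ∨ mu = 2 then 0 else (lam / (2 - lam) + mu / (2 - mu))⁻¹

/-- The undirected graph on the indices of the sets with edges `{s j, t j}`. -/
def pairGraph {m l : ℕ} (s t : Fin l → Fin m) : SimpleGraph (Fin m) :=
  SimpleGraph.fromRel fun i k => ∃ j, s j = i ∧ t j = k

end

end CyclicGDR

/-! Write `d = x - p` and `e = r - q` for the two projection residuals of a step, where `r = x - lam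
• d`. Expanding the square and using superregularity in place of convexity gives, for common points
`c` of the two sets near `w`, `‖y - c‖² + gdrDecrease ≤ (1 + ε)‖x - c‖²`, with `ε` as small as
desired (`gdr_step_le`).

The decrease must control `‖d‖² + ‖e‖²`. If `min lam mu < 2`, this is algebra, and the bound on `al`
is what it needs (`exists_gdrDecrease_ge`). For two reflections only a multiple of `‖d + e‖²`
survives. Affine-hull regularity and compactness then keep `d` and `e` away from cancellation
(`exists_norm_add_ge_of_limitingNormalCone`), and the same condition makes the pair linearly regular
(`exists_infDist_inter_le`). This is valid only inside the affine hull; the orthogonal component is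
untouched by the step, which is why `Z` contains `Sᗮ`, where `S` is the direction of the hull.

Linear regularity of each pair turns the decrease into `IsQuasiFejerStep`, with `ν` independent of
`ε`. Summing over a cycle, linear regularity of the `Z j` makes the decrease outweigh the growth `(1
+ ε) ^ l`: the distance to `⋂ j, Z j` shrinks by a fixed factor per cycle while the iterates move by
at most three times that distance. Convergence is then a geometric series argument. -/

namespace CyclicGDR

/-! ### One generalized Douglas-Rachford step: expansion of the square and coercivity of the
decrease. -/

section OneStep

variable {X : Type*} [NormedAddCommGroup X]

lemma norm_sub_le_of_mem_projector {C : Set X} {x p c : X} (hp : p ∈ projector C x)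
    (hc : c ∈ C) : ‖x - p‖ ≤ ‖x - c‖ := by
  rw [hp.2, ← dist_eq_norm]
  exact Metric.infDist_le_dist_of_mem hc

lemma mem_projector_of_forall_le {C : Set X} {x p : X} (hp : p ∈ C)
    (h : ∀ c ∈ C, ‖x - p‖ ≤ ‖x - c‖) : p ∈ projector C x := by
  refine ⟨hp, le_antisymm ?_ ?_⟩
  · refine (Metric.le_infDist ⟨p, hp⟩).2 fun {c} hc => ?_
    rw [dist_eq_norm]
    exact h c hc
  · rw [← dist_eq_norm]
    exact Metric.infDist_le_dist_of_mem hp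

lemma projector_nonempty [ProperSpace X] {C : Set X} (hC : IsClosed C) (hne : C.Nonempty) (x : X) :
    (projector C x).Nonempty := by
  obtain ⟨p, hp, h⟩ := hC.exists_infDist_eq_dist hne x
  exact ⟨p, hp, by rw [h, dist_eq_norm]⟩

lemma mem_projector_self {C : Set X} {x : X} (hx : x ∈ C) : x ∈ projector C x :=
  mem_projector_of_forall_le hx fun c _ => by simp

lemma norm_sub_le_two_mul {C : Set X} {x p c : X} (hp : p ∈ projector C x)
    (hc : c ∈ C) : ‖p - c‖ ≤ 2 * ‖x - c‖ := by
  have h1 := norm_sub_le_of_mem_projector hp hc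
  have h2 : ‖p - c‖ ≤ ‖x - p‖ + ‖x - c‖ := by
    rw [norm_sub_rev x p]
    exact norm_sub_le_norm_sub_add_norm_sub p x c
  linarith

variable [InnerProductSpace ℝ X]

lemma sub_mem_proximalNormalCone {C : Set X} {x p : X} (hp : p ∈ projector C x) :
    x - p ∈ proximalNormalCone C p :=
  ⟨x, hp, 1, zero_le_one, (one_smul _ _).symm⟩

/-- A regular set is nearly supported by its proximal normals `x - p`. -/
lemma inner_sub_ge_of_isRegularAt {C : Set X} {ε δ : ℝ} {w x p c : X} (hε : 0 ≤ ε)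
    (hC : IsRegularAt C ε δ w) (hp : p ∈ projector C x) (hpw : p ∈ Metric.closedBall w δ)
    (hc : c ∈ C) (hcw : c ∈ Metric.closedBall w δ) :
    ‖x - p‖ ^ 2 - 2 * ε * ‖x - c‖ ^ 2 ≤ inner ℝ (x - p) (x - c) := by
  have h := hC p ⟨hp.1, hpw⟩ c ⟨hc, hcw⟩ _ (sub_mem_proximalNormalCone hp)
  have h1 : (inner ℝ (x - p) (x - c) : ℝ) = ‖x - p‖ ^ 2 + inner ℝ (x - p) (p - c) := by
    rw [← real_inner_self_eq_norm_sq, ← inner_add_right]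
    congr 1
    abel
  have h2 : ‖x - p‖ * ‖p - c‖ ≤ ‖x - c‖ * (2 * ‖x - c‖) :=
    mul_le_mul (norm_sub_le_of_mem_projector hp hc) (norm_sub_le_two_mul hp hc)
      (norm_nonneg _) (norm_nonneg _)
  have h3 := mul_le_mul_of_nonneg_left h2 hε
  rw [h1]
  nlinarith

/-- The product with `e` is based at the relaxed point `x - lam • d`, from which `e` is a projection
residual; moving the base point there creates the cross term, which the next lemma absorbs into
`‖lam • d + mu • e‖ ^ 2`. -/
lemma norm_sq_sub_smul_sub (x c d e : X) (lam mu al : ℝ) :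
    ‖x - al • (lam • d + mu • e) - c‖ ^ 2 =
      ‖x - c‖ ^ 2 - 2 * al * (lam * inner ℝ d (x - c) + mu * inner ℝ e (x - lam • d - c))
        - 2 * al * (lam * mu * inner ℝ d e) + al ^ 2 * ‖lam • d + mu • e‖ ^ 2 := by
  have h : x - al • (lam • d + mu • e) - c = (x - c) - al • (lam • d + mu • e) := by abel
  have h' : x - lam • d - c = (x - c) - lam • d := by abel
  rw [h, h', norm_sub_sq_real, norm_smul, mul_pow, Real.norm_eq_abs, sq_abs]
  simp only [inner_smul_right, inner_add_right, inner_sub_right, real_inner_comm d (x - c),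
    real_inner_comm e (x - c), real_inner_comm d e]
  ring

lemma norm_sq_smul_add_smul (d e : X) (lam mu : ℝ) :
    ‖lam • d + mu • e‖ ^ 2 =
      lam ^ 2 * ‖d‖ ^ 2 + 2 * (lam * mu * inner ℝ d e) + mu ^ 2 * ‖e‖ ^ 2 := by
  rw [norm_add_sq_real, norm_smul, norm_smul, mul_pow, mul_pow, Real.norm_eq_abs,
    Real.norm_eq_abs, sq_abs, sq_abs, real_inner_smul_left, real_inner_smul_right]
  ring

/-- The decrease of `‖· - c‖ ^ 2` along a generalized Douglas-Rachford step with
displacements `d` and `e`. -/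
def gdrDecrease (lam mu al : ℝ) (d e : X) : ℝ :=
  al * (1 - al) * ‖lam • d + mu • e‖ ^ 2 +
    al * ((2 - lam) * lam * ‖d‖ ^ 2 + (2 - mu) * mu * ‖e‖ ^ 2)

lemma relaxed_eq (x p : X) (lam : ℝ) : (1 - lam) • x + lam • p = x - lam • (x - p) := by
  module

lemma norm_sub_smul_sub_le {x d c : X} {lam : ℝ} (hlam : lam ∈ Ioc (0 : ℝ) 2)
    (hd : ‖d‖ ≤ ‖x - c‖) : ‖x - lam • d - c‖ ≤ 3 * ‖x - c‖ := by
  have h : x - lam • d - c = (x - c) - lam • d := by abel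
  rw [h]
  refine (norm_sub_le _ _).trans ?_
  rw [norm_smul, Real.norm_eq_abs, abs_of_pos hlam.1]
  nlinarith [hlam.2, norm_nonneg d, hlam.1]

lemma gdr_step_le {A B : Set X} {lam mu al ε δ : ℝ} {w x p q c : X}
    (hlam : lam ∈ Ioc (0 : ℝ) 2) (hmu : mu ∈ Ioc (0 : ℝ) 2) (hal : 0 < al) (hε : 0 ≤ ε)
    (hA : IsRegularAt A ε δ w) (hB : IsRegularAt B ε δ w) (hwA : w ∈ A) (hwB : w ∈ B)
    (hx : 6 * ‖x - w‖ ≤ δ) (hc : ‖c - w‖ ≤ δ) (hcA : c ∈ A) (hcB : c ∈ B)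
    (hp : p ∈ projector A x) (hq : q ∈ projector B (x - lam • (x - p))) :
    ‖x - al • (lam • (x - p) + mu • (x - lam • (x - p) - q)) - c‖ ^ 2 +
      gdrDecrease lam mu al (x - p) (x - lam • (x - p) - q) ≤
        (1 + 80 * al * ε) * ‖x - c‖ ^ 2 := by
  have hpw := norm_sub_le_two_mul hp hwA
  have hqw := norm_sub_le_two_mul hq hwB
  have hrw := norm_sub_smul_sub_le hlam (norm_sub_le_of_mem_projector hp hwA)
  have hrc := norm_sub_smul_sub_le hlam (norm_sub_le_of_mem_projector hp hcA)
  have hx0 := norm_nonneg (x - w)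
  have h1 := inner_sub_ge_of_isRegularAt hε hA hp
    (mem_closedBall_iff_norm.2 (by linarith)) hcA (mem_closedBall_iff_norm.2 hc)
  have h2 := inner_sub_ge_of_isRegularAt hε hB hq
    (mem_closedBall_iff_norm.2 (by linarith)) hcB (mem_closedBall_iff_norm.2 hc)
  set d := x - p
  set e := x - lam • d - q
  have h3 : ‖x - lam • d - c‖ ^ 2 ≤ 9 * ‖x - c‖ ^ 2 := by
    nlinarith [norm_nonneg (x - lam • d - c), norm_nonneg (x - c)]
  have h2' : ‖e‖ ^ 2 - 18 * (ε * ‖x - c‖ ^ 2) ≤ inner ℝ e (x - lam • d - c) := by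
    have := mul_le_mul_of_nonneg_left h3 hε
    linarith
  have h4 := mul_le_mul_of_nonneg_left h1 (mul_nonneg hal.le hlam.1.le)
  have h5 := mul_le_mul_of_nonneg_left h2' (mul_nonneg hal.le hmu.1.le)
  -- The errors are `2 * ε` at `x` and `18 * ε = 2 * 9 * ε` at the relaxed point; multiplied by `2 *
  -- al * lam` and `2 * al * mu`, with `lam, mu ≤ 2`, they add up to `(8 + 72) * al * ε`.
  rw [gdrDecrease, norm_sq_sub_smul_sub, norm_sq_smul_add_smul]
  have h6 : al * lam * (ε * ‖x - c‖ ^ 2) ≤ 2 * al * (ε * ‖x - c‖ ^ 2) :=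
    mul_le_mul_of_nonneg_right (by nlinarith [hlam.2]) (by positivity)
  have h7 : al * mu * (ε * ‖x - c‖ ^ 2) ≤ 2 * al * (ε * ‖x - c‖ ^ 2) :=
    mul_le_mul_of_nonneg_right (by nlinarith [hmu.2]) (by positivity)
  linarith

/-- Weighted Cauchy-Schwarz; the defect is an explicit square. The constant is the inverse of
`betaHat`. -/
lemma norm_sq_le_of_lt_two {lam mu : ℝ} (hlam : lam ∈ Ioo (0 : ℝ) 2) (hmu : mu ∈ Ioo (0 : ℝ) 2)
    (d e : X) : ‖lam • d + mu • e‖ ^ 2 ≤ (lam / (2 - lam) + mu / (2 - mu)) *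
      ((2 - lam) * lam * ‖d‖ ^ 2 + (2 - mu) * mu * ‖e‖ ^ 2) := by
  have h1 : 0 < 2 - lam := by linarith [hlam.2]
  have h2 : 0 < 2 - mu := by linarith [hmu.2]
  have h0 := hlam.1
  have h0' := hmu.1
  have h3 : ‖lam • d + mu • e‖ ≤ lam * ‖d‖ + mu * ‖e‖ := by
    refine (norm_add_le _ _).trans_eq ?_
    rw [norm_smul, norm_smul, Real.norm_eq_abs, Real.norm_eq_abs, abs_of_pos h0, abs_of_pos h0']
  refine (pow_le_pow_left₀ (norm_nonneg _) h3 2).trans ?_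
  have h4 : (lam / (2 - lam) + mu / (2 - mu)) *
      ((2 - lam) * lam * ‖d‖ ^ 2 + (2 - mu) * mu * ‖e‖ ^ 2) - (lam * ‖d‖ + mu * ‖e‖) ^ 2 =
      lam * mu / ((2 - lam) * (2 - mu)) * ((2 - lam) * ‖d‖ - (2 - mu) * ‖e‖) ^ 2 := by
    field_simp
    ring
  have h5 : 0 ≤ lam * mu / ((2 - lam) * (2 - mu)) * ((2 - lam) * ‖d‖ - (2 - mu) * ‖e‖) ^ 2 := by
    positivity
  linarith

/-- When `lam = 2` the coefficient of `‖d‖ ^ 2` in the decrease vanishes, so `d` is recovered from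
the total displacement and `e`. -/
lemma norm_sq_le_two_mul_add {lam mu : ℝ} (hmu : mu ∈ Ioc (0 : ℝ) 2) (hlam : lam = 2) (d e : X) :
    ‖d‖ ^ 2 + ‖e‖ ^ 2 ≤ 3 * (‖lam • d + mu • e‖ ^ 2 + ‖e‖ ^ 2) := by
  have h1 : lam * ‖d‖ ≤ ‖lam • d + mu • e‖ + mu * ‖e‖ := by
    have h : lam • d = (lam • d + mu • e) - mu • e := by abel
    calc lam * ‖d‖ = ‖lam • d‖ := by
          rw [norm_smul, Real.norm_eq_abs, abs_of_pos (by linarith)]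
      _ ≤ ‖lam • d + mu • e‖ + ‖mu • e‖ := by
          conv_lhs => rw [h]
          exact norm_sub_le _ _
      _ = _ := by rw [norm_smul, Real.norm_eq_abs, abs_of_pos hmu.1]
  have h2 : 2 * ‖d‖ ≤ ‖lam • d + mu • e‖ + 2 * ‖e‖ := by
    rw [hlam] at h1 ⊢
    nlinarith [hmu.2, norm_nonneg e]
  nlinarith [norm_nonneg d, norm_nonneg e, norm_nonneg (lam • d + mu • e),
    sq_nonneg (‖lam • d + mu • e‖ - 2 * ‖e‖)]

lemma gdrDecrease_swap (lam mu al : ℝ) (d e : X) :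
    gdrDecrease lam mu al d e = gdrDecrease mu lam al e d := by
  rw [gdrDecrease, gdrDecrease, add_comm (lam • d), add_comm ((2 - lam) * lam * ‖d‖ ^ 2)]

lemma exists_gdrDecrease_ge_of_eq_two {lam mu al : ℝ} (hlam : lam = 2)
    (hmu : mu ∈ Ioo (0 : ℝ) 2) (hal : al ∈ Ioo (0 : ℝ) 1) :
    ∃ ν > 0, ∀ d e : X, ν * (‖d‖ ^ 2 + ‖e‖ ^ 2) ≤ gdrDecrease lam mu al d e := by
  have h0 := hmu.1
  have h1 : 0 < 2 - mu := by linarith [hmu.2]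
  have h2 := hal.1
  have h3 : 0 < 1 - al := by linarith [hal.2]
  refine ⟨min (al * (1 - al)) (al * ((2 - mu) * mu)) / 3, by positivity, fun d e => ?_⟩
  set k := min (al * (1 - al)) (al * ((2 - mu) * mu))
  have hk : 0 < k := by positivity
  have h4 := norm_sq_le_two_mul_add ⟨hmu.1, hmu.2.le⟩ hlam d e
  have h5 : k * ‖lam • d + mu • e‖ ^ 2 ≤ al * (1 - al) * ‖lam • d + mu • e‖ ^ 2 :=
    mul_le_mul_of_nonneg_right (min_le_left _ _) (by positivity)
  have h6 : k * ‖e‖ ^ 2 ≤ al * ((2 - mu) * mu) * ‖e‖ ^ 2 :=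
    mul_le_mul_of_nonneg_right (min_le_right _ _) (by positivity)
  have h7 := mul_le_mul_of_nonneg_left h4 hk.le
  have h8 : (2 - lam) * lam * ‖d‖ ^ 2 = 0 := by rw [hlam]; ring
  rw [gdrDecrease, h8]
  linarith

lemma exists_gdrDecrease_ge {lam mu al : ℝ} (hlam : lam ∈ Ioc (0 : ℝ) 2)
    (hmu : mu ∈ Ioc (0 : ℝ) 2) (hal : al ∈ Ioo (0 : ℝ) (1 + betaHat lam mu))
    (hmin : min lam mu < 2) :
    ∃ ν > 0, ∀ d e : X, ν * (‖d‖ ^ 2 + ‖e‖ ^ 2) ≤ gdrDecrease lam mu al d e := by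
  rcases hlam.2.eq_or_lt with h2 | h2
  · have hmu2 : mu < 2 := by simpa [h2] using hmin
    have hal' : al ∈ Ioo (0 : ℝ) 1 := by simpa [betaHat, h2] using hal
    exact exists_gdrDecrease_ge_of_eq_two h2 ⟨hmu.1, hmu2⟩ hal'
  rcases hmu.2.eq_or_lt with h2' | h2'
  · have hal' : al ∈ Ioo (0 : ℝ) 1 := by simpa [betaHat, h2'] using hal
    obtain ⟨ν, hν, h⟩ := exists_gdrDecrease_ge_of_eq_two (X := X) h2' ⟨hlam.1, h2⟩ hal'
    refine ⟨ν, hν, fun d e => ?_⟩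
    rw [gdrDecrease_swap, add_comm (‖d‖ ^ 2)]
    exact h e d
  have h0 := hlam.1
  have h0' := hmu.1
  have ha0 := hal.1
  have h1 : 0 < 2 - lam := by linarith
  have h1' : 0 < 2 - mu := by linarith
  set b := lam / (2 - lam) + mu / (2 - mu) with hb
  have hb0 : 0 < b := by positivity
  have hal1 : al < 1 + b⁻¹ := by
    have := hal.2
    rwa [betaHat, if_neg (by rintro (h | h) <;> linarith)] at this
  have hf : 0 < 1 - (al - 1) * b := by
    have : (al - 1) * b < b⁻¹ * b := mul_lt_mul_of_pos_right (by linarith) hb0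
    rw [inv_mul_cancel₀ hb0.ne'] at this
    linarith
  -- For `al ≤ 1` the first term of the decrease is nonnegative and the factor 1 works; for `al ≥ 1`
  -- it costs at most `(al - 1) * b * S`, and `1 - (al - 1) * b` is positive exactly when `al < 1 +
  -- b⁻¹`.
  set k := min 1 (1 - (al - 1) * b) with hk
  have hk0 : 0 < k := lt_min one_pos hf
  set n := min ((2 - lam) * lam) ((2 - mu) * mu) with hn
  have hn0 : 0 < n := lt_min (by positivity) (by positivity)
  refine ⟨al * (k * n), by positivity, fun d e => ?_⟩
  have hS := norm_sq_le_of_lt_two (X := X) ⟨h0, h2⟩ ⟨h0', h2'⟩ d e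
  rw [gdrDecrease]
  set S := (2 - lam) * lam * ‖d‖ ^ 2 + (2 - mu) * mu * ‖e‖ ^ 2 with hSdef
  have hS0 : n * (‖d‖ ^ 2 + ‖e‖ ^ 2) ≤ S := by
    have h5 : n * ‖d‖ ^ 2 ≤ (2 - lam) * lam * ‖d‖ ^ 2 :=
      mul_le_mul_of_nonneg_right (min_le_left _ _) (by positivity)
    have h6 : n * ‖e‖ ^ 2 ≤ (2 - mu) * mu * ‖e‖ ^ 2 :=
      mul_le_mul_of_nonneg_right (min_le_right _ _) (by positivity)
    linarith
  have hS1 : 0 ≤ S := le_trans (by positivity) hS0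
  have key : k * S ≤ (1 - al) * ‖lam • d + mu • e‖ ^ 2 + S := by
    rcases le_total al 1 with h | h
    · have : k * S ≤ 1 * S := mul_le_mul_of_nonneg_right (min_le_left _ _) hS1
      have : 0 ≤ (1 - al) * ‖lam • d + mu • e‖ ^ 2 := mul_nonneg (by linarith) (by positivity)
      linarith
    · have h7 : k * S ≤ (1 - (al - 1) * b) * S := mul_le_mul_of_nonneg_right (min_le_right _ _) hS1
      have h8 := mul_le_mul_of_nonneg_left hS (sub_nonneg.2 h)
      linarith
  have h9 := mul_le_mul_of_nonneg_left hS0 hk0.le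
  have h10 := mul_le_mul_of_nonneg_left (h9.trans key) ha0.le
  linarith

end OneStep

end CyclicGDR

namespace CyclicGDR

/-! ### Quasi Fejér steps from a coercive decrease and linear regularity. -/

section QuasiFejer

lemma iInter_pair {X : Type*} (A B : Set X) : ⋂ i, ![A, B] i = A ∩ B := by
  ext x
  simp [Fin.forall_fin_two]

lemma iUnion_pair {X : Type*} (A B : Set X) : ⋃ i, ![A, B] i = A ∪ B := by
  ext x
  simp [Fin.exists_fin_two]

variable {X : Type*} [NormedAddCommGroup X]

/-- Near `w`, a step of `T` is quasi Fejér monotone with respect to `Z`, with a decrease that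
controls both the length of the step and the distance to `Z`. -/
def IsQuasiFejerStep (T : X → Set X) (Z : Set X) (w : X) (ν : ℝ) : Prop :=
  ∀ ε > 0, ∃ δ > 0, ∀ x, ‖x - w‖ ≤ δ → ∀ y ∈ T x, ∀ c ∈ Z, ‖c - w‖ ≤ δ →
    ‖y - c‖ ^ 2 + ν * (‖y - x‖ ^ 2 + Metric.infDist x Z ^ 2) ≤ (1 + ε) * ‖x - c‖ ^ 2

lemma IsQuasiFejerStep.mono {T : X → Set X} {Z : Set X} {w : X} {ν ν' : ℝ}
    (h : IsQuasiFejerStep T Z w ν) (hν : ν' ≤ ν) : IsQuasiFejerStep T Z w ν' := by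
  intro ε hε
  obtain ⟨δ, hδ, H⟩ := h ε hε
  refine ⟨δ, hδ, fun x hx y hy c hc hcw => le_trans ?_ (H x hx y hy c hc hcw)⟩
  gcongr

variable [InnerProductSpace ℝ X]

lemma IsRegularAt.mono {C : Set X} {ε δ δ' : ℝ} {w : X} (h : IsRegularAt C ε δ w)
    (hδ : δ' ≤ δ) : IsRegularAt C ε δ' w := fun x hx y hy u hu =>
  h x ⟨hx.1, Metric.closedBall_subset_closedBall hδ hx.2⟩ y
    ⟨hy.1, Metric.closedBall_subset_closedBall hδ hy.2⟩ u hu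

lemma smul_mem_proximalNormalCone {C : Set X} {x u : X} {c : ℝ} (hc : 0 ≤ c)
    (hu : u ∈ proximalNormalCone C x) : c • u ∈ proximalNormalCone C x := by
  obtain ⟨z, hz, b, hb, rfl⟩ := hu
  exact ⟨z, hz, c * b, mul_nonneg hc hb, smul_smul _ _ _⟩

/-- The one-step inequality on the affine subspace `w + S`, from a lower bound of the decrease
and the linear regularity of the two sets. -/
lemma exists_quasiFejer_of_decrease {A B : Set X} {lam mu al ν κ δ₀ : ℝ} {w : X}
    {S : Submodule ℝ X} (hlam : lam ∈ Ioc (0 : ℝ) 2) (hmu : mu ∈ Ioc (0 : ℝ) 2) (hal : 0 < al)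
    (hA : IsSuperregularAt A w) (hB : IsSuperregularAt B w) (hwA : w ∈ A) (hwB : w ∈ B)
    (hν : 0 < ν) (hδ₀ : 0 < δ₀) (hκ : 0 < κ)
    (hdec : ∀ x, ‖x - w‖ ≤ δ₀ → x - w ∈ S → ∀ p ∈ projector A x,
      ∀ q ∈ projector B (x - lam • (x - p)),
        ν * (‖x - p‖ ^ 2 + ‖x - lam • (x - p) - q‖ ^ 2) ≤
          gdrDecrease lam mu al (x - p) (x - lam • (x - p) - q))
    (hlin : ∀ x, ‖x - w‖ ≤ δ₀ →
      Metric.infDist x (A ∩ B) ≤ κ * max (Metric.infDist x A) (Metric.infDist x B)) :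
    ∃ ν > 0, ∀ ε > 0, ∃ δ > 0, ∀ x, ‖x - w‖ ≤ δ → x - w ∈ S → ∀ p ∈ projector A x,
      ∀ q ∈ projector B (x - lam • (x - p)), ∀ c ∈ A ∩ B, ‖c - w‖ ≤ δ →
        ‖x - al • (lam • (x - p) + mu • (x - lam • (x - p) - q)) - c‖ ^ 2 +
          ν * (‖al • (lam • (x - p) + mu • (x - lam • (x - p) - q))‖ ^ 2 +
            Metric.infDist x (A ∩ B) ^ 2) ≤ (1 + ε) * ‖x - c‖ ^ 2 := by
  -- The squared step length is at most `8 * al ^ 2` times `‖d‖ ^ 2 + ‖e‖ ^ 2`, and the squared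
  -- distance to `A ∩ B` at most `8 * κ ^ 2` times it. This constant is fixed before `ε`.
  refine ⟨ν / (8 * (al ^ 2 + κ ^ 2)), by positivity, fun ε hε => ?_⟩
  obtain ⟨δA, hδA, hrA⟩ := hA (ε / (80 * al)) (by positivity)
  obtain ⟨δB, hδB, hrB⟩ := hB (ε / (80 * al)) (by positivity)
  set δ := min (min δA δB) δ₀ with hδ
  have hδpos : 0 < δ := lt_min (lt_min hδA hδB) hδ₀
  refine ⟨δ / 6, by positivity, fun x hx hxS p hp q hq c hc hcw => ?_⟩
  have hxδ₀ : ‖x - w‖ ≤ δ₀ := by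
    have : δ ≤ δ₀ := min_le_right _ _
    linarith
  have hstep := gdr_step_le (al := al) (ε := ε / (80 * al)) (δ := δ) hlam hmu hal (by positivity)
    (hrA.mono ((min_le_left _ _).trans (min_le_left _ _)))
    (hrB.mono ((min_le_left _ _).trans (min_le_right _ _))) hwA hwB (by linarith) (by linarith)
    hc.1 hc.2 hp hq
  have hd := hdec x hxδ₀ hxS p hp q hq
  have hreg := hlin x hxδ₀
  have hε' : 80 * al * (ε / (80 * al)) = ε := by field_simp
  rw [hε'] at hstep
  refine le_trans ?_ hstep
  have hdA : Metric.infDist x A = ‖x - p‖ := hp.2.symm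
  have hdB : Metric.infDist x B ≤ 2 * ‖x - p‖ + ‖x - lam • (x - p) - q‖ := by
    have h1 := Metric.infDist_le_dist_of_mem (x := x) hq.1
    rw [dist_eq_norm] at h1
    have h2 : x - q = lam • (x - p) + (x - lam • (x - p) - q) := by abel
    rw [h2] at h1
    refine h1.trans ((norm_add_le _ _).trans ?_)
    rw [norm_smul, Real.norm_eq_abs, abs_of_pos hlam.1]
    nlinarith [hlam.2, norm_nonneg (x - p)]
  set d := x - p
  set e := x - lam • d - q
  have hd0 := norm_nonneg d
  have he0 := norm_nonneg e
  have h1 : Metric.infDist x (A ∩ B) ≤ κ * (2 * ‖d‖ + ‖e‖) :=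
    hreg.trans (mul_le_mul_of_nonneg_left (max_le (by linarith) hdB) hκ.le)
  have h2 : Metric.infDist x (A ∩ B) ^ 2 ≤ κ ^ 2 * (8 * (‖d‖ ^ 2 + ‖e‖ ^ 2)) := by
    refine (pow_le_pow_left₀ Metric.infDist_nonneg h1 2).trans ?_
    rw [mul_pow]
    refine mul_le_mul_of_nonneg_left ?_ (sq_nonneg κ)
    nlinarith [sq_nonneg (‖d‖ - 2 * ‖e‖)]
  have h3 : ‖lam • d + mu • e‖ ≤ 2 * (‖d‖ + ‖e‖) := by
    refine (norm_add_le _ _).trans ?_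
    rw [norm_smul, norm_smul, Real.norm_eq_abs, Real.norm_eq_abs, abs_of_pos hlam.1,
      abs_of_pos hmu.1]
    nlinarith [hlam.2, hmu.2]
  have h4 : ‖al • (lam • d + mu • e)‖ ^ 2 ≤ al ^ 2 * (8 * (‖d‖ ^ 2 + ‖e‖ ^ 2)) := by
    rw [norm_smul, mul_pow, Real.norm_eq_abs, sq_abs]
    refine mul_le_mul_of_nonneg_left ?_ (sq_nonneg al)
    refine (pow_le_pow_left₀ (norm_nonneg _) h3 2).trans ?_
    nlinarith [sq_nonneg (‖d‖ - ‖e‖)]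
  have h5 : ν / (8 * (al ^ 2 + κ ^ 2)) * (‖al • (lam • d + mu • e)‖ ^ 2 +
      Metric.infDist x (A ∩ B) ^ 2) ≤ ν * (‖d‖ ^ 2 + ‖e‖ ^ 2) := by
    calc _ ≤ ν / (8 * (al ^ 2 + κ ^ 2)) * (8 * (al ^ 2 + κ ^ 2) * (‖d‖ ^ 2 + ‖e‖ ^ 2)) := by
          refine mul_le_mul_of_nonneg_left ?_ (by positivity)
          linarith
      _ = _ := by field_simp
  linarith

lemma mem_gdrOperator_iff {A B : Set X} {lam mu al : ℝ} {x y : X} :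
    y ∈ gdrOperator A B lam mu al x ↔ ∃ p ∈ projector A x, ∃ q ∈ projector B (x - lam • (x - p)),
      y = x - al • (lam • (x - p) + mu • (x - lam • (x - p) - q)) := by
  have key (p q : X) : (1 - al) • x + al • ((1 - mu) • (x - lam • (x - p)) + mu • q) =
      x - al • (lam • (x - p) + mu • (x - lam • (x - p) - q)) := by
    module
  constructor
  · rintro ⟨r, ⟨p, hp, rfl⟩, s, ⟨q, hq, rfl⟩, rfl⟩
    rw [relaxed_eq x p] at hq ⊢
    exact ⟨p, hp, q, hq, key p q⟩
  · rintro ⟨p, hp, q, hq, rfl⟩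
    refine ⟨_, ⟨p, hp, rfl⟩, _, ⟨q, ?_, rfl⟩, ?_⟩
    · rwa [relaxed_eq]
    · rw [relaxed_eq x p]
      exact (key p q).symm

lemma exists_isQuasiFejerStep_of_isLinearlyRegularAround {A B : Set X} {lam mu al : ℝ} {w : X}
    (hlam : lam ∈ Ioc (0 : ℝ) 2) (hmu : mu ∈ Ioc (0 : ℝ) 2)
    (hal : al ∈ Ioo (0 : ℝ) (1 + betaHat lam mu)) (hmin : min lam mu < 2)
    (hA : IsSuperregularAt A w) (hB : IsSuperregularAt B w) (hwA : w ∈ A) (hwB : w ∈ B)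
    (hlin : IsLinearlyRegularAround ![A, B] w) :
    ∃ ν > 0, IsQuasiFejerStep (gdrOperator A B lam mu al) (A ∩ B) w ν := by
  obtain ⟨δ₀, hδ₀, κ, hκ, hreg⟩ := hlin
  obtain ⟨ν₀, hν₀, hdec⟩ := exists_gdrDecrease_ge (X := X) hlam hmu hal hmin
  obtain ⟨ν, hν, h⟩ := exists_quasiFejer_of_decrease (S := ⊤) hlam hmu hal.1 hA hB hwA hwB hν₀ hδ₀
    hκ (fun x _ _ p _ q _ => hdec _ _) (fun x hx => by
      have h := hreg x (mem_closedBall_iff_norm.2 hx)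
      rw [iInter_pair] at h
      refine h.trans (mul_le_mul_of_nonneg_left (ciSup_le fun i => ?_) hκ.le)
      fin_cases i
      · exact le_max_left _ _
      · exact le_max_right _ _)
  refine ⟨ν, hν, fun ε hε => ?_⟩
  obtain ⟨δ, hδ, H⟩ := h ε hε
  refine ⟨δ, hδ, fun x hx y hy c hc hcw => ?_⟩
  obtain ⟨p, hp, q, hq, rfl⟩ := mem_gdrOperator_iff.1 hy
  have h' := H x hx trivial p hp q hq c hc hcw
  rwa [sub_sub_cancel_left, norm_neg]

/-! ### From limiting normals at one point to uniform estimates and linear regularity of a pair. -/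

/-- The constraint qualification at `w` within the subspace `S` extends uniformly to proximal
normals near `w`. -/
lemma exists_norm_add_ge_of_limitingNormalCone [FiniteDimensional ℝ X] {A B : Set X} {w : X}
    {S : Submodule ℝ X}
    (h : ∀ u ∈ limitingNormalCone A w, u ∈ S → -u ∈ limitingNormalCone B w → u = 0) :
    ∃ δ > 0, ∃ θ > 0, θ ≤ 1 ∧ ∀ p, ‖p - w‖ ≤ δ → p ∈ A → ∀ q, ‖q - w‖ ≤ δ → q ∈ B →
      ∀ u ∈ proximalNormalCone A p, u ∈ S → ∀ v ∈ proximalNormalCone B q,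
        θ * (‖u‖ + ‖v‖) ≤ ‖u + v‖ := by
  -- Normalise violating pairs so that `‖U n‖ + ‖V n‖ = 1`. Along a subsequence `U` tends to some
  -- `a` and `V` to `-a`; the hypothesis forces `a = 0`, against the normalisation.
  by_contra! H
  have hpos (n : ℕ) : (0 : ℝ) < 1 / ((n : ℝ) + 1) := Nat.one_div_pos_of_nat
  have hle (n : ℕ) : 1 / ((n : ℝ) + 1) ≤ 1 := by
    rw [div_le_one (by positivity)]
    linarith [Nat.cast_nonneg (α := ℝ) n]
  choose p hpw hpA q hqw hqB u hu huS v hv huv using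
    fun n : ℕ => H (1 / ((n : ℝ) + 1)) (hpos n) (1 / ((n : ℝ) + 1)) (hpos n) (hle n)
  have ht (n : ℕ) : 0 < ‖u n‖ + ‖v n‖ :=
    pos_of_mul_pos_right ((norm_nonneg _).trans_lt (huv n)) (hpos n).le
  set t : ℕ → ℝ := fun n => (‖u n‖ + ‖v n‖)⁻¹
  have ht0 (n : ℕ) : 0 < t n := inv_pos.2 (ht n)
  set U : ℕ → X := fun n => t n • u n
  set V : ℕ → X := fun n => t n • v n
  have hUn (n : ℕ) : ‖U n‖ = t n * ‖u n‖ := by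
    rw [norm_smul, Real.norm_eq_abs, abs_of_pos (ht0 n)]
  have hVn (n : ℕ) : ‖V n‖ = t n * ‖v n‖ := by
    rw [norm_smul, Real.norm_eq_abs, abs_of_pos (ht0 n)]
  have hsum (n : ℕ) : ‖U n‖ + ‖V n‖ = 1 := by
    rw [hUn, hVn, ← mul_add]
    exact inv_mul_cancel₀ (ht n).ne'
  have hUV (n : ℕ) : ‖U n + V n‖ ≤ 1 / ((n : ℝ) + 1) := by
    have h1 : U n + V n = t n • (u n + v n) := (smul_add _ _ _).symm
    rw [h1, norm_smul, Real.norm_eq_abs, abs_of_pos (ht0 n)]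
    calc t n * ‖u n + v n‖ ≤ t n * (1 / ((n : ℝ) + 1) * (‖u n‖ + ‖v n‖)) :=
          mul_le_mul_of_nonneg_left (huv n).le (ht0 n).le
      _ = 1 / ((n : ℝ) + 1) * (t n * (‖u n‖ + ‖v n‖)) := by ring
      _ = 1 / ((n : ℝ) + 1) := by rw [inv_mul_cancel₀ (ht n).ne', mul_one]
  have hball (n : ℕ) : U n ∈ Metric.closedBall (0 : X) 1 := by
    rw [mem_closedBall_zero_iff]
    linarith [hsum n, norm_nonneg (V n)]
  have : ProperSpace X := FiniteDimensional.proper ℝ X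
  obtain ⟨a, -, φ, hφ, hlim⟩ := (isCompact_closedBall (0 : X) 1).tendsto_subseq hball
  have hone : Tendsto (fun n : ℕ => 1 / ((n : ℝ) + 1)) atTop (𝓝 0) :=
    tendsto_one_div_add_atTop_nhds_zero_nat
  have hUV0 : Tendsto (fun n => U n + V n) atTop (𝓝 0) := squeeze_zero_norm hUV hone
  have hV : Tendsto (V ∘ φ) atTop (𝓝 (-a)) := by
    have h1 := (hUV0.comp hφ.tendsto_atTop).sub hlim
    rw [zero_sub] at h1
    refine h1.congr fun n => ?_
    simp
  have hpt : Tendsto p atTop (𝓝 w) := by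
    rw [tendsto_iff_norm_sub_tendsto_zero]
    exact squeeze_zero (fun _ => norm_nonneg _) hpw hone
  have hqt : Tendsto q atTop (𝓝 w) := by
    rw [tendsto_iff_norm_sub_tendsto_zero]
    exact squeeze_zero (fun _ => norm_nonneg _) hqw hone
  have ha0 : a = 0 := by
    refine h a ⟨p ∘ φ, U ∘ φ, fun n => hpA _, fun n => ?_, hpt.comp hφ.tendsto_atTop, hlim⟩ ?_
      ⟨q ∘ φ, V ∘ φ, fun n => hqB _, fun n => ?_, hqt.comp hφ.tendsto_atTop, hV⟩
    · exact smul_mem_proximalNormalCone (ht0 _).le (hu _)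
    · exact (Submodule.closed_of_finiteDimensional S).mem_of_tendsto hlim
        (Eventually.of_forall fun n => S.smul_mem _ (huS _))
    · exact smul_mem_proximalNormalCone (ht0 _).le (hv _)
  have h1 : Tendsto (fun n => ‖(U ∘ φ) n‖ + ‖(V ∘ φ) n‖) atTop (𝓝 (‖a‖ + ‖-a‖)) :=
    hlim.norm.add hV.norm
  have h2 : Tendsto (fun n => ‖(U ∘ φ) n‖ + ‖(V ∘ φ) n‖) atTop (𝓝 1) :=
    tendsto_const_nhds.congr fun n => (hsum (φ n)).symm
  have h3 := tendsto_nhds_unique h1 h2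
  simp [ha0] at h3

/-- One step of alternating projections is a strict contraction of the gap. -/
lemma norm_le_of_norm_add_ge {u v : X} {θ : ℝ} (hθ : θ ≤ 1) (huv : ‖u‖ ≤ ‖v‖)
    (h : ∀ a b : ℝ, 0 ≤ a → 0 ≤ b → θ * (‖a • u‖ + ‖b • v‖) ≤ ‖a • u + b • v‖) (hθ0 : 0 < θ)
    (hreg : inner ℝ u (u + v) ≤ θ ^ 2 / 2 * (‖u‖ * ‖u + v‖)) :
    ‖u‖ ≤ (1 - θ ^ 2) * ‖v‖ := by
  have hu0 := norm_nonneg u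
  have hv0 := norm_nonneg v
  have hθ1 : 0 ≤ 1 - θ ^ 2 := by nlinarith
  rcases hu0.eq_or_lt with h0 | h0
  · rw [← h0]
    positivity
  have hv : 0 < ‖v‖ := h0.trans_le huv
  -- These weights give both vectors the length `‖u‖ * ‖v‖`, so squaring yields the angle bound `(2
  -- * θ ^ 2 - 1) * (‖u‖ * ‖v‖) ≤ inner ℝ u v`.
  have h1 := h ‖v‖ ‖u‖ hv0 hu0
  rw [norm_smul, norm_smul, norm_norm, norm_norm] at h1
  have h2 := pow_le_pow_left₀ (by positivity) h1 2
  rw [norm_sq_smul_add_smul] at h2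
  have h3 : ‖u‖ * ‖v‖ * ((2 * θ ^ 2 - 1) * (‖u‖ * ‖v‖)) ≤ ‖u‖ * ‖v‖ * inner ℝ u v := by
    nlinarith
  have h4 := le_of_mul_le_mul_left h3 (mul_pos h0 hv)
  rw [inner_add_right, real_inner_self_eq_norm_sq] at hreg
  have h5 : ‖u + v‖ ≤ 2 * ‖v‖ := (norm_add_le _ _).trans (by linarith)
  have h6 := mul_le_mul_of_nonneg_left (mul_le_mul_of_nonneg_left h5 hu0)
    (show 0 ≤ θ ^ 2 / 2 by positivity)
  have h7 : ‖u‖ * ‖u‖ ≤ ‖u‖ * ((1 - θ ^ 2) * ‖v‖) := by linarith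
  exact le_of_mul_le_mul_left h7 h0

/-- A uniform constraint qualification for proximal normals within a subspace containing all
differences of points of the sets gives linear regularity of the pair. -/
lemma exists_infDist_inter_le [FiniteDimensional ℝ X] {A B : Set X} {w : X}
    {S : Submodule ℝ X} {δ θ : ℝ} (hcA : IsClosed A) (hcB : IsClosed B) (hwA : w ∈ A)
    (hwB : w ∈ B) (hAS : ∀ a ∈ A, a - w ∈ S) (hBS : ∀ b ∈ B, b - w ∈ S)
    (hδ : 0 < δ) (hθ : 0 < θ) (hθ1 : θ ≤ 1) (hreg : IsRegularAt A (θ ^ 2 / 2) δ w)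
    (hCQ : ∀ p, ‖p - w‖ ≤ δ → p ∈ A → ∀ q, ‖q - w‖ ≤ δ → q ∈ B →
      ∀ u ∈ proximalNormalCone A p, u ∈ S → ∀ v ∈ proximalNormalCone B q,
        θ * (‖u‖ + ‖v‖) ≤ ‖u + v‖) :
    ∃ δ' > 0, ∃ κ > 0, ∀ x, ‖x - w‖ ≤ δ' →
      Metric.infDist x (A ∩ B) ≤ κ * max (Metric.infDist x A) (Metric.infDist x B) := by
  have : ProperSpace X := FiniteDimensional.proper ℝ X
  -- Slope of an Ekeland-type penalty: minimise `infDist p B + τ * ‖p - p₀‖` over `p ∈ A`. If `p ∉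
  -- B`, projecting to `q ∈ B` and back to `p₁ ∈ A` lowers the gap by at least `θ ^ 2 * ‖p - q‖` and
  -- raises the penalty by at most `2 * τ * ‖p - q‖`, half of that, contradicting minimality.
  set τ : ℝ := θ ^ 2 / 4 with hτ
  have hτ0 : 0 < τ := by positivity
  have hτ1 : τ ≤ 1 := by nlinarith
  refine ⟨δ * τ / 8, by positivity, 1 + 2 / τ, by positivity, fun x hx => ?_⟩
  obtain ⟨p₀, hp₀⟩ := projector_nonempty hcA ⟨w, hwA⟩ x
  have hF : ContinuousOn (fun p => Metric.infDist p B + τ * ‖p - p₀‖) A := by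
    refine Continuous.continuousOn ?_
    have := Metric.continuous_infDist_pt B
    fun_prop
  obtain ⟨p, hpA, hpmin⟩ := hF.exists_isMinOn' hcA hp₀.1 (by
    refine Eventually.filter_mono inf_le_left ?_
    filter_upwards [(isCompact_closedBall p₀ (Metric.infDist p₀ B / τ)).compl_mem_cocompact]
      with p hp
    rw [mem_compl_iff, mem_closedBall_iff_norm, not_le, div_lt_iff₀ hτ0] at hp
    simp only [sub_self, norm_zero, mul_zero, add_zero]
    linarith [Metric.infDist_nonneg (x := p) (s := B)])
  have hmin (z : X) (hz : z ∈ A) : Metric.infDist p B + τ * ‖p - p₀‖ ≤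
      Metric.infDist z B + τ * ‖z - p₀‖ := hpmin hz
  have hp₀w := norm_sub_le_two_mul hp₀ hwA
  have hdp₀ : Metric.infDist p₀ B ≤ ‖p₀ - w‖ := by
    rw [← dist_eq_norm]
    exact Metric.infDist_le_dist_of_mem hwB
  have hpp₀ : Metric.infDist p B + τ * ‖p - p₀‖ ≤ Metric.infDist p₀ B := by
    simpa using hmin p₀ hp₀.1
  have hpB : p ∈ B := by
    obtain ⟨q, hq⟩ := projector_nonempty hcB ⟨w, hwB⟩ p
    obtain ⟨p₁, hp₁⟩ := projector_nonempty hcA ⟨w, hwA⟩ q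
    have hpq : ‖p - q‖ = Metric.infDist p B := hq.2
    have hle : ‖q - p₁‖ ≤ ‖p - q‖ := by
      rw [norm_sub_rev p q]
      exact norm_sub_le_of_mem_projector hp₁ hpA
    have hp₁p : ‖p₁ - p‖ ≤ 2 * ‖p - q‖ := by
      rw [norm_sub_rev p q]
      exact norm_sub_le_two_mul hp₁ hpA
    have hn₀ := norm_nonneg (p - p₀)
    have hn₁ := norm_nonneg (p - q)
    have e8 : 8 * (δ * τ / 8) = τ * δ := by ring
    have hpp₀' : ‖p - p₀‖ ≤ δ / 4 := by
      have : τ * ‖p - p₀‖ ≤ τ * (δ / 4) := by linarith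
      exact le_of_mul_le_mul_left this hτ0
    have hτδ : τ * δ ≤ δ := mul_le_of_le_one_left hδ.le hτ1
    have hpw : ‖p - w‖ ≤ δ / 2 := by
      have := norm_sub_le_norm_sub_add_norm_sub p p₀ w
      linarith
    have hpqs : ‖p - q‖ ≤ δ / 4 := by
      have := mul_nonneg hτ0.le hn₀
      linarith
    have hqw : ‖q - w‖ ≤ δ := by
      have := norm_sub_le_norm_sub_add_norm_sub q p w
      rw [norm_sub_rev q p] at this
      linarith
    have hp₁w : ‖p₁ - w‖ ≤ δ := by
      have := norm_sub_le_norm_sub_add_norm_sub p₁ p w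
      linarith
    have huA := sub_mem_proximalNormalCone hp₁
    have hvB := sub_mem_proximalNormalCone hq
    have huS : q - p₁ ∈ S := by
      have := S.sub_mem (hBS q hq.1) (hAS p₁ hp₁.1)
      rwa [sub_sub_sub_cancel_right] at this
    have hr := hreg p₁ ⟨hp₁.1, mem_closedBall_iff_norm.2 hp₁w⟩ p
      ⟨hpA, mem_closedBall_iff_norm.2 (by linarith)⟩ _ huA
    have hsum : p₁ - p = -((q - p₁) + (p - q)) := by abel
    rw [hsum, inner_neg_right, norm_neg] at hr
    have hc := norm_le_of_norm_add_ge hθ1 hle (fun a b ha hb =>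
      hCQ p₁ hp₁w hp₁.1 q hqw hq.1 _ (smul_mem_proximalNormalCone ha huA) (S.smul_mem _ huS) _
        (smul_mem_proximalNormalCone hb hvB)) hθ (by linarith)
    have hm := hmin p₁ hp₁.1
    have hd₁ : Metric.infDist p₁ B ≤ ‖q - p₁‖ := by
      rw [norm_sub_rev, ← dist_eq_norm]
      exact Metric.infDist_le_dist_of_mem hq.1
    have htri : ‖p₁ - p₀‖ ≤ ‖p₁ - p‖ + ‖p - p₀‖ := norm_sub_le_norm_sub_add_norm_sub _ _ _
    have h1 := mul_le_mul_of_nonneg_left (htri.trans (add_le_add_left hp₁p _)) hτ0.le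
    have h2 : θ ^ 2 / 2 * ‖p - q‖ ≤ 0 := by
      rw [hτ] at h1 hm
      linarith
    have h3 : ‖p - q‖ = 0 := by
      refine le_antisymm ?_ hn₁
      by_contra! hcon
      have : 0 < θ ^ 2 / 2 * ‖p - q‖ := by positivity
      linarith
    rw [norm_eq_zero, sub_eq_zero] at h3
    exact h3 ▸ hq.1
  have h1 : Metric.infDist x (A ∩ B) ≤ ‖x - p‖ := by
    rw [← dist_eq_norm]
    exact Metric.infDist_le_dist_of_mem ⟨hpA, hpB⟩
  have h2 : ‖x - p‖ ≤ ‖x - p₀‖ + ‖p - p₀‖ := by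
    rw [norm_sub_rev p p₀]
    exact norm_sub_le_norm_sub_add_norm_sub _ _ _
  have h3 : Metric.infDist p₀ B ≤ Metric.infDist x B + ‖x - p₀‖ := by
    have := Metric.infDist_le_infDist_add_dist (s := B) (x := p₀) (y := x)
    rwa [dist_comm, dist_eq_norm] at this
  have h4 : ‖x - p₀‖ = Metric.infDist x A := hp₀.2
  set M := max (Metric.infDist x A) (Metric.infDist x B)
  have h5 : Metric.infDist x A ≤ M := le_max_left _ _
  have h6 : Metric.infDist x B ≤ M := le_max_right _ _
  have h7 : ‖p - p₀‖ ≤ 2 / τ * M := by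
    rw [div_mul_eq_mul_div, le_div_iff₀ hτ0]
    linarith [Metric.infDist_nonneg (x := p) (s := B)]
  linarith

end QuasiFejer

end CyclicGDR

namespace CyclicGDR

/-! ### The case of two reflections, and the geometry of the sets `Z`. -/

section Reflections

variable {X : Type*} [NormedAddCommGroup X]

lemma projector_eq_singleton_of_mem {A : Set X} {x : X} (hx : x ∈ A) : projector A x = {x} := by
  ext p
  constructor
  · intro hp
    have h := norm_sub_le_of_mem_projector hp hx
    rw [sub_self, norm_zero] at h
    exact (sub_eq_zero.1 (norm_le_zero_iff.1 h)).symm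
  · rintro rfl
    exact mem_projector_self hx

variable [InnerProductSpace ℝ X]

lemma norm_sq_add_of_mem_orthogonal {S : Submodule ℝ X} {a v : X} (ha : a ∈ S) (hv : v ∈ Sᗮ) :
    ‖a + v‖ ^ 2 = ‖a‖ ^ 2 + ‖v‖ ^ 2 := by
  rw [norm_add_sq_real, Submodule.inner_right_of_mem_orthogonal ha hv]
  ring

/-- The projector onto a subset of `x' + S` does not see displacements orthogonal to `S`. -/
lemma projector_eq_of_sub_mem_orthogonal {S : Submodule ℝ X} {A : Set X} {x x' : X}
    (hA : ∀ a ∈ A, x' - a ∈ S) (hx : x - x' ∈ Sᗮ) : projector A x = projector A x' := by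
  have key : ∀ a ∈ A, ‖x - a‖ ^ 2 = ‖x' - a‖ ^ 2 + ‖x - x'‖ ^ 2 := fun a ha => by
    rw [← norm_sq_add_of_mem_orthogonal (hA a ha) hx]
    congr 2
    abel
  ext p
  constructor
  · intro hp
    refine mem_projector_of_forall_le hp.1 fun c hc => ?_
    have h := pow_le_pow_left₀ (norm_nonneg _) (norm_sub_le_of_mem_projector hp hc) 2
    rw [key p hp.1, key c hc] at h
    exact pow_le_pow_iff_left₀ (norm_nonneg _) (norm_nonneg _) two_ne_zero |>.1 (by linarith)
  · intro hp
    refine mem_projector_of_forall_le hp.1 fun c hc => ?_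
    have h := pow_le_pow_left₀ (norm_nonneg _) (norm_sub_le_of_mem_projector hp hc) 2
    refine pow_le_pow_iff_left₀ (norm_nonneg _) (norm_nonneg _) two_ne_zero |>.1 ?_
    rw [key p hp.1, key c hc]
    linarith

lemma sub_mem_direction_affineSpan {E : Set X} {a b : X} (ha : a ∈ E) (hb : b ∈ E) :
    a - b ∈ (affineSpan ℝ E).direction :=
  AffineSubspace.vsub_mem_direction (subset_affineSpan ℝ E ha) (subset_affineSpan ℝ E hb)

/-- The reflection case `lam = mu = 2`. -/
lemma exists_isQuasiFejerStep_of_isAffineHullRegularAt [FiniteDimensional ℝ X] {A B : Set X}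
    {al : ℝ} {w : X} (hal : al ∈ Ioo (0 : ℝ) 1) (hcA : IsClosed A) (hcB : IsClosed B)
    (hA : IsSuperregularAt A w) (hB : IsSuperregularAt B w) (hwA : w ∈ A) (hwB : w ∈ B)
    (haff : IsAffineHullRegularAt ![A, B] w) :
    ∃ ν > 0, IsQuasiFejerStep (gdrOperator A B 2 2 al)
      ((A ∩ B) + (((affineSpan ℝ (A ∪ B)).directionᗮ : Submodule ℝ X) : Set X)) w ν := by
  have hwL : w ∈ affineSpan ℝ (A ∪ B) := subset_affineSpan ℝ _ (Or.inl hwA)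
  have hAS : ∀ a ∈ A, a - w ∈ (affineSpan ℝ (A ∪ B)).direction := fun a ha =>
    sub_mem_direction_affineSpan (Or.inl ha) (Or.inl hwA)
  have hBS : ∀ b ∈ B, b - w ∈ (affineSpan ℝ (A ∪ B)).direction := fun b hb =>
    sub_mem_direction_affineSpan (Or.inr hb) (Or.inl hwA)
  have hmem (u : X) (hu : u ∈ (affineSpan ℝ (A ∪ B)).direction) :
      u + w ∈ affineSpan ℝ (A ∪ B) := by
    rw [← vadd_eq_add]
    exact AffineSubspace.vadd_mem_of_mem_direction hu hwL
  have hN : ∀ u ∈ limitingNormalCone A w, u ∈ (affineSpan ℝ (A ∪ B)).direction →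
      -u ∈ limitingNormalCone B w → u = 0 := by
    intro u huA huS huB
    rw [IsAffineHullRegularAt, iUnion_pair] at haff
    refine haff ![u, -u] (by simp) (fun i => ?_) 0
    fin_cases i
    · exact ⟨huA, hmem u huS⟩
    · exact ⟨huB, hmem _ (Submodule.neg_mem _ huS)⟩
  set S := (affineSpan ℝ (A ∪ B)).direction with hS
  obtain ⟨δ₁, hδ₁, θ, hθ, hθ1, hCQ⟩ := exists_norm_add_ge_of_limitingNormalCone hN
  obtain ⟨δ₂, hδ₂, hreg⟩ := hA (θ ^ 2 / 2) (by positivity)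
  obtain ⟨δ₃, hδ₃, κ, hκ, hlin⟩ := exists_infDist_inter_le (δ := min δ₁ δ₂) hcA hcB hwA hwB hAS hBS
    (lt_min hδ₁ hδ₂) hθ hθ1 (hreg.mono (min_le_right _ _))
    (fun p hp hpA q hq hqB => hCQ p (hp.trans (min_le_left _ _)) hpA q
      (hq.trans (min_le_left _ _)) hqB)
  have h2 : (2 : ℝ) ∈ Ioc (0 : ℝ) 2 := ⟨two_pos, le_rfl⟩
  have hal0 := hal.1
  have hal1 : 0 < 1 - al := by linarith [hal.2]
  obtain ⟨ν, hν, H⟩ := exists_quasiFejer_of_decrease (S := S) (δ₀ := min δ₃ (δ₁ / 6))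
    (ν := al * (1 - al) * (4 * θ ^ 2)) h2 h2 hal.1 hA hB hwA hwB (by positivity)
    (lt_min hδ₃ (by positivity)) hκ (by
      intro x hx hxS p hp q hq
      have hx' : ‖x - w‖ ≤ δ₁ / 6 := hx.trans (min_le_right _ _)
      have hpw := norm_sub_le_two_mul hp hwA
      have hqw := norm_sub_le_two_mul hq hwB
      have hrw := norm_sub_smul_sub_le h2 (norm_sub_le_of_mem_projector hp hwA)
      have hdS : x - p ∈ S := by
        have := S.sub_mem hxS (hAS p hp.1)
        rwa [sub_sub_sub_cancel_right] at this
      have h := hCQ p (by linarith [norm_nonneg (x - w)]) hp.1 q (by linarith) hq.1 _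
        (sub_mem_proximalNormalCone hp) hdS _ (sub_mem_proximalNormalCone hq)
      set d := x - p
      set e := x - (2 : ℝ) • d - q
      have h3 := pow_le_pow_left₀ (by positivity) h 2
      have h4 : ‖(2 : ℝ) • d + (2 : ℝ) • e‖ ^ 2 = 4 * ‖d + e‖ ^ 2 := by
        rw [← smul_add, norm_smul, mul_pow]
        norm_num
      have h5 : θ ^ 2 * (‖d‖ ^ 2 + ‖e‖ ^ 2) ≤ ‖d + e‖ ^ 2 := by
        refine le_trans ?_ h3
        rw [mul_pow]
        refine mul_le_mul_of_nonneg_left ?_ (sq_nonneg θ)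
        nlinarith [mul_nonneg (norm_nonneg d) (norm_nonneg e)]
      have h6 := mul_le_mul_of_nonneg_left h5 (mul_pos hal0 hal1).le
      rw [gdrDecrease, h4]
      linarith)
    (fun x hx => hlin x (hx.trans (min_le_left _ _)))
  refine ⟨ν, hν, fun ε hε => ?_⟩
  obtain ⟨δ, hδ, H⟩ := H ε hε
  refine ⟨δ, hδ, ?_⟩
  rintro x hx y hy c ⟨a, ha, n, hn, rfl⟩ hcw
  change n ∈ Sᗮ at hn
  obtain ⟨p, hp, q, hq, rfl⟩ := mem_gdrOperator_iff.1 hy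
  -- `x'` is the orthogonal projection of `x` onto the affine hull. Each reflection reverses `v`, so
  -- the two together leave it unchanged and the displacements at `x` and `x'` agree.
  obtain ⟨b, hb, v, hv, hbv⟩ := S.exists_add_mem_mem_orthogonal (x - w)
  have hxb : x = (w + b) + v := by rw [add_assoc, ← hbv]; abel
  set x' := w + b with hx'
  have hx'S : x' - w ∈ S := by rwa [hx', add_sub_cancel_left]
  have hxx' : x - x' = v := by rw [hxb]; abel
  have hA' : ∀ a ∈ A, x' - a ∈ S := fun a ha => by
    have := S.sub_mem hx'S (hAS a ha)
    rwa [sub_sub_sub_cancel_right] at this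
  rw [projector_eq_of_sub_mem_orthogonal hA' (by rwa [hxx'])] at hp
  have hr : (x - (2 : ℝ) • (x - p)) - (x' - (2 : ℝ) • (x' - p)) = -v := by
    rw [hxb]
    module
  have hB' : ∀ b ∈ B, x' - (2 : ℝ) • (x' - p) - b ∈ S := fun b hb => by
    have := S.sub_mem (S.sub_mem hx'S (S.smul_mem (2 : ℝ) (hA' p hp.1))) (hBS b hb)
    rwa [show x' - w - (2 : ℝ) • (x' - p) - (b - w) = x' - (2 : ℝ) • (x' - p) - b by abel] at this
  rw [projector_eq_of_sub_mem_orthogonal hB' (by rw [hr]; exact Submodule.neg_mem _ hv)] at hq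
  have hpyth (z : X) (hz : z ∈ S) (n : X) (hn : n ∈ Sᗮ) : ‖z‖ ≤ ‖z + n‖ := by
    refine pow_le_pow_iff_left₀ (norm_nonneg _) (norm_nonneg _) two_ne_zero |>.1 ?_
    rw [norm_sq_add_of_mem_orthogonal hz hn]
    linarith [sq_nonneg ‖n‖]
  have hx'w : ‖x' - w‖ ≤ δ := by
    refine (hpyth _ hx'S v hv).trans ?_
    rwa [show x' - w + v = x - w by rw [hxb]; abel]
  have haw : ‖a - w‖ ≤ δ := by
    refine (hpyth _ (hAS a ha.1) n hn).trans ?_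
    rwa [show a - w + n = a + n - w by abel]
  have h := H x' hx'w hx'S p hp q hq a ha haw
  set D' := al • ((2 : ℝ) • (x' - p) + (2 : ℝ) • (x' - (2 : ℝ) • (x' - p) - q)) with hD'
  have hD : al • ((2 : ℝ) • (x - p) + (2 : ℝ) • (x - (2 : ℝ) • (x - p) - q)) = D' := by
    rw [hD', hxb]
    module
  have hDS : D' ∈ S := S.smul_mem _ (S.add_mem (S.smul_mem _ (hA' p hp.1))
    (S.smul_mem _ (hB' q hq.1)))
  have hvn : v - n ∈ Sᗮ := Submodule.sub_mem _ hv hn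
  -- By Pythagoras both sides of the inequality at `x'` gain the same `‖v - n‖ ^ 2`; the factor `1 +
  -- ε ≥ 1` keeps the inequality.
  have e1 : ‖x - D' - (a + n)‖ ^ 2 = ‖x' - D' - a‖ ^ 2 + ‖v - n‖ ^ 2 := by
    have hm : x' - D' - a ∈ S := by
      have := S.sub_mem (hA' a ha.1) hDS
      rwa [sub_right_comm] at this
    rw [← norm_sq_add_of_mem_orthogonal hm hvn, hxb]
    congr 2
    abel
  have e2 : ‖x - (a + n)‖ ^ 2 = ‖x' - a‖ ^ 2 + ‖v - n‖ ^ 2 := by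
    rw [← norm_sq_add_of_mem_orthogonal (hA' a ha.1) hvn, hxb]
    congr 2
    abel
  have e3 : Metric.infDist x ((A ∩ B) + ((Sᗮ : Submodule ℝ X) : Set X)) ≤
      Metric.infDist x' (A ∩ B) := by
    refine (Metric.le_infDist ⟨a, ha⟩).2 fun {z} hz => ?_
    have : dist x (z + v) = dist x' z := by
      rw [hxb, dist_add_right]
    rw [← this]
    exact Metric.infDist_le_dist_of_mem ⟨z, hz, v, hv, rfl⟩
  rw [hD, e1, e2, sub_sub_cancel_left, norm_neg]
  have e4 := mul_le_mul_of_nonneg_left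
    (add_le_add_right (pow_le_pow_left₀ Metric.infDist_nonneg e3 2) (‖D'‖ ^ 2)) hν.le
  have e5 : 0 ≤ ε * ‖v - n‖ ^ 2 := by positivity
  linarith

lemma exists_isQuasiFejerStep_gdr [FiniteDimensional ℝ X] {A B : Set X} {lam mu al : ℝ} {w : X}
    (hlam : lam ∈ Ioc (0 : ℝ) 2) (hmu : mu ∈ Ioc (0 : ℝ) 2)
    (hal : al ∈ Ioo (0 : ℝ) (1 + betaHat lam mu)) (hcA : IsClosed A) (hcB : IsClosed B)
    (hA : IsSuperregularAt A w) (hB : IsSuperregularAt B w) (hwA : w ∈ A) (hwB : w ∈ B)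
    (hlin : min lam mu < 2 → IsLinearlyRegularAround ![A, B] w)
    (haff : ¬ min lam mu < 2 → IsAffineHullRegularAt ![A, B] w) :
    ∃ ν > 0, IsQuasiFejerStep (gdrOperator A B lam mu al) (gdrSet A B lam mu) w ν := by
  by_cases hmin : min lam mu < 2
  · have h : ¬ (lam = 2 ∧ mu = 2) := by
      rintro ⟨rfl, rfl⟩
      simp at hmin
    rw [gdrSet, if_neg h]
    exact exists_isQuasiFejerStep_of_isLinearlyRegularAround hlam hmu hal hmin hA hB hwA hwB
      (hlin hmin)
  · have h := haff hmin
    rw [not_lt, le_min_iff] at hmin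
    obtain rfl : lam = 2 := le_antisymm hlam.2 hmin.1
    obtain rfl : mu = 2 := le_antisymm hmu.2 hmin.2
    rw [gdrSet, if_pos ⟨rfl, rfl⟩]
    exact exists_isQuasiFejerStep_of_isAffineHullRegularAt (by simpa [betaHat] using hal) hcA hcB
      hA hB hwA hwB h

lemma isClosed_inter_add_orthogonal {A B : Set X} (hcA : IsClosed A) (hcB : IsClosed B)
    [FiniteDimensional ℝ X] :
    IsClosed ((A ∩ B) + (((affineSpan ℝ (A ∪ B)).directionᗮ : Submodule ℝ X) : Set X)) := by
  rcases (A ∩ B).eq_empty_or_nonempty with h | ⟨w, hw⟩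
  · rw [h, empty_add]
    exact isClosed_empty
  set S := (affineSpan ℝ (A ∪ B)).direction with hS
  -- A sum of closed sets need not be closed; this one is the preimage of `A ∩ B` under the
  -- orthogonal projection onto the affine hull.
  have heq : (A ∩ B) + ((Sᗮ : Submodule ℝ X) : Set X) =
      (fun x => w + S.starProjection (x - w)) ⁻¹' (A ∩ B) := by
    ext x
    constructor
    · rintro ⟨a, ha, n, hn, rfl⟩
      have haS : a - w ∈ S := sub_mem_direction_affineSpan (Or.inl ha.1) (Or.inl hw.1)
      have hP : S.starProjection (a + n - w) = a - w := by
        rw [add_sub_right_comm, map_add, S.starProjection_eq_self_iff.2 haS,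
          (S.starProjection_apply_eq_zero_iff).2 hn, add_zero]
      simp only [mem_preimage]
      rw [hP]
      simpa using ha
    · intro hx
      refine ⟨_, hx, (x - w) - S.starProjection (x - w),
        S.sub_starProjection_mem_orthogonal _, ?_⟩
      exact (add_add_sub_cancel _ _ _).trans (add_sub_cancel _ _)
  rw [heq]
  exact (hcA.inter hcB).preimage (by fun_prop)

lemma isClosed_gdrSet [FiniteDimensional ℝ X] {A B : Set X} (hcA : IsClosed A) (hcB : IsClosed B)
    (lam mu : ℝ) : IsClosed (gdrSet A B lam mu) := by
  rw [gdrSet]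
  split_ifs
  · exact isClosed_inter_add_orthogonal hcA hcB
  · exact hcA.inter hcB

lemma inter_subset_gdrSet (A B : Set X) (lam mu : ℝ) : A ∩ B ⊆ gdrSet A B lam mu := by
  intro x hx
  rw [gdrSet]
  split_ifs
  · exact ⟨x, hx, 0, Submodule.zero_mem _, add_zero x⟩
  · exact hx

/-- The points of `Z` have a unique projection onto each of the two sets, the same for both. -/
lemma exists_projector_eq_singleton_of_mem_gdrSet {A B : Set X} {lam mu : ℝ} {x : X}
    (hx : x ∈ gdrSet A B lam mu) :
    ∃ c ∈ A ∩ B, projector A x = {c} ∧ projector B x = {c} := by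
  rw [gdrSet] at hx
  split_ifs at hx
  · obtain ⟨c, hc, n, hn, rfl⟩ := hx
    have h : c + n - c ∈ ((affineSpan ℝ (A ∪ B)).direction)ᗮ := by rwa [add_sub_cancel_left]
    refine ⟨c, hc, ?_, ?_⟩
    · rw [projector_eq_of_sub_mem_orthogonal
        (fun a ha => sub_mem_direction_affineSpan (E := A ∪ B) (Or.inl hc.1) (Or.inl ha)) h]
      exact projector_eq_singleton_of_mem hc.1
    · rw [projector_eq_of_sub_mem_orthogonal
        (fun b hb => sub_mem_direction_affineSpan (E := A ∪ B) (Or.inl hc.1) (Or.inr hb)) h]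
      exact projector_eq_singleton_of_mem hc.2
  · exact ⟨x, hx, projector_eq_singleton_of_mem hx.1, projector_eq_singleton_of_mem hx.2⟩

/-- With two reflections, `c + n` is sent to `c - n` and then back to `c + n`, both projections
being `c`. -/
lemma gdrSet_subset_fixedPoints (A B : Set X) (lam mu al : ℝ) :
    gdrSet A B lam mu ⊆ fixedPoints (gdrOperator A B lam mu al) := by
  intro x hx
  by_cases h : lam = 2 ∧ mu = 2
  · obtain ⟨rfl, rfl⟩ := h
    rw [gdrSet, if_pos ⟨rfl, rfl⟩] at hx
    obtain ⟨c, hc, n, hn, rfl⟩ := hx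
    refine mem_gdrOperator_iff.2 ⟨c, ?_, c, ?_, ?_⟩
    · rw [projector_eq_of_sub_mem_orthogonal (A := A) (x' := c)
        (fun a ha => sub_mem_direction_affineSpan (E := A ∪ B) (Or.inl hc.1) (Or.inl ha))
        (by rwa [add_sub_cancel_left]), projector_eq_singleton_of_mem hc.1]
      rfl
    · rw [projector_eq_of_sub_mem_orthogonal (A := B) (x' := c)
        (fun b hb => sub_mem_direction_affineSpan (E := A ∪ B) (Or.inl hc.1) (Or.inr hb)) ?_,
        projector_eq_singleton_of_mem hc.2]
      · rfl
      · rw [show c + n - (2 : ℝ) • (c + n - c) - c = -n by module]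
        exact Submodule.neg_mem _ hn
    · module
  · rw [gdrSet, if_neg h] at hx
    refine mem_gdrOperator_iff.2 ⟨x, mem_projector_self hx.1, x, ?_, by simp⟩
    simpa using mem_projector_self hx.2

end Reflections

end CyclicGDR

namespace CyclicGDR

/-! ### From single steps to whole cycles, and `R`-linear convergence. -/

section Cycles

variable {X : Type*} [NormedAddCommGroup X]

/-- The effect of one cycle of quasi Fejér steps on the distance to the intersection `W`. -/
lemma cycle_estimate [ProperSpace X] {l : ℕ} {E : ℕ → Set X} {W : Set X} {w : X} {y : ℕ → X}
    {ν κ ε δ : ℝ} (hW : IsClosed W) (hw : w ∈ W) (hWE : ∀ k < l, W ⊆ E k) (hν : 0 < ν)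
    (hκ : 0 < κ) (hε : 0 ≤ ε) (hε4 : (1 + ε) ^ l ≤ 4)
    (hstep : ∀ k < l, ‖y k - w‖ ≤ δ → ∀ c ∈ E k, ‖c - w‖ ≤ δ →
      ‖y (k + 1) - c‖ ^ 2 + ν * (‖y (k + 1) - y k‖ ^ 2 + Metric.infDist (y k) (E k) ^ 2) ≤
        (1 + ε) * ‖y k - c‖ ^ 2)
    (hreg : ∀ M, (∀ k < l, Metric.infDist (y 0) (E k) ≤ M) → Metric.infDist (y 0) W ≤ κ * M)
    (hy : 4 * ‖y 0 - w‖ ≤ δ) :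
    (∀ k ≤ l, ‖y k - y 0‖ ≤ 3 * Metric.infDist (y 0) W) ∧
      Metric.infDist (y l) W ^ 2 ≤
        ((1 + ε) ^ l - ν / (κ * (l + 1)) ^ 2) * Metric.infDist (y 0) W ^ 2 := by
  obtain ⟨c, hcW, hc⟩ := projector_nonempty hW ⟨w, hw⟩ (y 0)
  set D := Metric.infDist (y 0) W with hD
  have hD0 : 0 ≤ D := Metric.infDist_nonneg
  have hcw : ‖c - w‖ ≤ 2 * ‖y 0 - w‖ := norm_sub_le_two_mul ⟨hcW, hc⟩ hw
  have hDw : D ≤ ‖y 0 - w‖ := by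
    rw [hD, ← dist_eq_norm]
    exact Metric.infDist_le_dist_of_mem hw
  set r : ℕ → ℝ := fun i => ‖y (i + 1) - y i‖ ^ 2 + Metric.infDist (y i) (E i) ^ 2 with hr
  have hr0 (i : ℕ) : 0 ≤ r i := by positivity
  have hpow (k : ℕ) (hk : k ≤ l) : (1 + ε) ^ k ≤ 4 :=
    (pow_le_pow_right₀ (by linarith) hk).trans hε4
  have hsub (k : ℕ) (hk : k ≤ l)
      (h : ‖y k - c‖ ^ 2 + ν * ∑ i ∈ Finset.range k, r i ≤ (1 + ε) ^ k * D ^ 2) :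
      ‖y k - c‖ ≤ 2 * D := by
    have h1 : 0 ≤ ν * ∑ i ∈ Finset.range k, r i :=
      mul_nonneg hν.le (Finset.sum_nonneg fun i _ => hr0 i)
    have h2 := mul_le_mul_of_nonneg_right (hpow k hk) (sq_nonneg D)
    exact pow_le_pow_iff_left₀ (norm_nonneg _) (by positivity) two_ne_zero |>.1 (by linarith)
  -- The induction also keeps the iterates in the region where `hstep` applies: `(1 + ε) ^ k ≤ 4`
  -- gives `‖y k - c‖ ≤ 2 * D`, hence `‖y k - w‖ ≤ 4 * ‖y 0 - w‖ ≤ δ`.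
  have hind : ∀ k ≤ l, ‖y k - c‖ ^ 2 + ν * ∑ i ∈ Finset.range k, r i ≤ (1 + ε) ^ k * D ^ 2 := by
    intro k
    induction k with
    | zero => simp [hc]
    | succ k ih =>
      intro hk
      have ihk := ih (by omega)
      have hyk := hsub k (by omega) ihk
      have hykw := norm_sub_le_norm_sub_add_norm_sub (y k) c w
      have hs := hstep k (by omega) (by linarith) c (hWE k (by omega) hcW)
        (by linarith [norm_nonneg (y 0 - w)])
      have h1 : 0 ≤ ε * (ν * ∑ i ∈ Finset.range k, r i) :=
        mul_nonneg hε (mul_nonneg hν.le (Finset.sum_nonneg fun i _ => hr0 i))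
      have h2 := mul_le_mul_of_nonneg_left ihk (show 0 ≤ 1 + ε by linarith)
      rw [Finset.sum_range_succ, pow_succ (1 + ε) k]
      change _ + ν * (_ + (‖y (k + 1) - y k‖ ^ 2 + Metric.infDist (y k) (E k) ^ 2)) ≤ _
      linarith
  refine ⟨fun k hk => ?_, ?_⟩
  · have h1 := hsub k hk (hind k hk)
    have h2 := norm_sub_le_norm_sub_add_norm_sub (y k) c (y 0)
    rw [norm_sub_rev c, hc] at h2
    linarith
  · set R := ∑ i ∈ Finset.range l, r i with hR
    have hR0 : 0 ≤ R := Finset.sum_nonneg fun i _ => hr0 i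
    have hrR (i : ℕ) (hi : i < l) : r i ≤ R :=
      Finset.single_le_sum (fun i _ => hr0 i) (Finset.mem_range.2 hi)
    have hyR (i : ℕ) (hi : i < l) : ‖y (i + 1) - y i‖ ≤ √R := by
      refine Real.le_sqrt_of_sq_le (le_trans ?_ (hrR i hi))
      exact le_add_of_nonneg_right (sq_nonneg _)
    have hdR (i : ℕ) (hi : i < l) : Metric.infDist (y i) (E i) ≤ √R := by
      refine Real.le_sqrt_of_sq_le (le_trans ?_ (hrR i hi))
      exact le_add_of_nonneg_left (sq_nonneg _)
    have hdist : ∀ k ≤ l, dist (y 0) (y k) ≤ k * √R := by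
      intro k
      induction k with
      | zero => simp
      | succ k ih =>
        intro hk
        have h1 := dist_triangle (y 0) (y k) (y (k + 1))
        have h2 := ih (by omega)
        have h3 := hyR k (by omega)
        rw [← dist_eq_norm, dist_comm] at h3
        push_cast
        linarith
    -- Each `E k` is reached from `y 0` by at most `l` steps and one distance term, all bounded by
    -- `√R`.
    have hM : D ≤ κ * ((l + 1) * √R) := by
      refine hreg _ fun k hk => ?_
      have h1 := Metric.infDist_le_infDist_add_dist (s := E k) (x := y 0) (y := y k)
      have h2 := hdist k hk.le
      have h3 := hdR k hk
      have h4 : (k : ℝ) * √R ≤ l * √R :=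
        mul_le_mul_of_nonneg_right (by exact_mod_cast hk.le) (Real.sqrt_nonneg _)
      linarith
    have hD2 : D ^ 2 ≤ (κ * (l + 1)) ^ 2 * R := by
      refine (pow_le_pow_left₀ hD0 hM 2).trans_eq ?_
      rw [← mul_assoc, mul_pow, Real.sq_sqrt hR0]
    have hpos : 0 < (κ * (l + 1)) ^ 2 := by positivity
    have h1 : ν / (κ * (l + 1)) ^ 2 * D ^ 2 ≤ ν * R := by
      rw [div_mul_eq_mul_div, div_le_iff₀ hpos]
      linarith [mul_le_mul_of_nonneg_left hD2 hν.le]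
    have h2 : Metric.infDist (y l) W ≤ ‖y l - c‖ := by
      rw [← dist_eq_norm]
      exact Metric.infDist_le_dist_of_mem hcW
    have h3 := pow_le_pow_left₀ Metric.infDist_nonneg h2 2
    have h4 := hind l le_rfl
    linarith

lemma exists_pow_one_add_le (l : ℕ) {η : ℝ} (hη : 0 < η) : ∃ ε > 0, (1 + ε) ^ l ≤ 1 + η := by
  have h : ContinuousAt (fun ε : ℝ => (1 + ε) ^ l) 0 := by fun_prop
  obtain ⟨δ, hδ, H⟩ := Metric.continuousAt_iff.1 h η hη
  refine ⟨δ / 2, by positivity, ?_⟩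
  have h1 := H (x := δ / 2) (by
    rw [dist_zero_right, Real.norm_eq_abs, abs_of_pos (by positivity)]
    linarith)
  rw [add_zero, one_pow, Real.dist_eq] at h1
  linarith [le_abs_self ((1 + δ / 2) ^ l - 1)]

/-- A sequence whose blocks of length `l` satisfy a linear decrease of the distance to `W`
converges `R`-linearly to a point of `W`. -/
lemma exists_convergesRLinearly [CompleteSpace X] {l : ℕ} (hl : 0 < l) {W : Set X}
    {w : X} {r δ : ℝ} (hW : IsClosed W) (hw : w ∈ W) (hr0 : 0 < r) (hr1 : r < 1) (hδ : 0 < δ) :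
    ∃ δ' > 0, ∃ ρ : ℝ, 0 ≤ ρ ∧ ρ < 1 ∧ ∀ x : ℕ → X, ‖x 0 - w‖ ≤ δ' →
      (∀ n, ‖x (l * n) - w‖ ≤ δ →
        (∀ k ≤ l, ‖x (l * n + k) - x (l * n)‖ ≤ 3 * Metric.infDist (x (l * n)) W) ∧
          Metric.infDist (x (l * n + l)) W ≤ r * Metric.infDist (x (l * n)) W) →
      ∃ a ∈ W, ConvergesRLinearly x a ρ := by
  -- `K` solves `K = 3 + K * r`, which makes `‖x (l * n) - w‖ + K * D n` nonincreasing in `n`; this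
  -- traps the iterates in the ball of radius `δ`.
  have hr1' : 0 < 1 - r := by linarith
  set K := 3 / (1 - r) with hK
  have hK0 : 0 < K := by positivity
  have hKr : K = 3 + K * r := by
    rw [hK]
    field_simp
    ring
  have hρ0 : 0 < r ^ (1 / (l : ℝ)) := Real.rpow_pos_of_pos hr0 _
  have hρl : (r ^ (1 / (l : ℝ))) ^ l = r := by
    rw [← Real.rpow_natCast, ← Real.rpow_mul hr0.le, one_div_mul_cancel (by positivity),
      Real.rpow_one]
  have hρ1 : r ^ (1 / (l : ℝ)) < 1 := Real.rpow_lt_one hr0.le hr1 (by positivity)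
  refine ⟨δ / (1 + K), by positivity, r ^ (1 / (l : ℝ)), hρ0.le, hρ1, fun x hx0 hx => ?_⟩
  set ρ := r ^ (1 / (l : ℝ))
  set D : ℕ → ℝ := fun n => Metric.infDist (x (l * n)) W with hD
  have hDn (n : ℕ) : 0 ≤ D n := Metric.infDist_nonneg
  have hD0 : D 0 ≤ ‖x 0 - w‖ := by
    rw [← dist_eq_norm]
    exact Metric.infDist_le_dist_of_mem hw
  rw [le_div_iff₀ (by positivity)] at hx0
  have hball : ∀ n, ‖x (l * n) - w‖ + K * D n ≤ δ := by
    intro n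
    induction n with
    | zero =>
      have := mul_le_mul_of_nonneg_left hD0 hK0.le
      rw [mul_zero]
      linarith
    | succ n ih =>
      obtain ⟨h1, h2⟩ := hx n (by linarith [mul_nonneg hK0.le (hDn n)])
      have h3 := h1 l le_rfl
      have h4 := norm_sub_le_norm_sub_add_norm_sub (x (l * n + l)) (x (l * n)) w
      change _ ≤ r * D n at h2
      change _ ≤ 3 * D n at h3
      have h5 := mul_le_mul_of_nonneg_left h2 hK0.le
      change ‖x (l * n + l) - w‖ + K * Metric.infDist (x (l * n + l)) W ≤ δ
      have h6 : K * D n = 3 * D n + K * (r * D n) := by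
        conv_lhs => rw [hKr]
        ring
      linarith
  have hx' (n : ℕ) := hx n (by linarith [hball n, mul_nonneg hK0.le (hDn n)])
  have hDr : ∀ n, D n ≤ D 0 * r ^ n := by
    intro n
    induction n with
    | zero => simp
    | succ n ih =>
      refine (hx' n).2.trans ((mul_le_mul_of_nonneg_left ih hr0.le).trans_eq ?_)
      rw [pow_succ]
      ring
  have hblock (n k : ℕ) (hk : k ≤ l) : ‖x (l * n + k) - x (l * n)‖ ≤ 3 * D 0 * r ^ n := by
    have := (hx' n).1 k hk
    change _ ≤ 3 * D n at this
    linarith [hDr n]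
  have hgeo (n : ℕ) : dist (x (l * n)) (x (l * (n + 1))) ≤ 3 * D 0 * r ^ n := by
    rw [dist_comm, dist_eq_norm]
    exact hblock n l le_rfl
  obtain ⟨a, ha⟩ := cauchySeq_tendsto_of_complete
    (cauchySeq_of_le_geometric r (3 * D 0) hr1 hgeo)
  have hdist := dist_le_of_le_geometric_of_tendsto r (3 * D 0) hr1 hgeo ha
  have haW : a ∈ W := by
    rw [hW.mem_iff_infDist_zero ⟨w, hw⟩]
    have h1 : Tendsto D atTop (𝓝 (Metric.infDist a W)) :=
      ((Metric.continuous_infDist_pt W).tendsto a).comp ha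
    have h2 : Tendsto D atTop (𝓝 0) := by
      refine squeeze_zero hDn hDr ?_
      simpa using (tendsto_pow_atTop_nhds_zero_of_lt_one hr0.le hr1).const_mul (D 0)
    exact tendsto_nhds_unique h1 h2
  -- Dividing by `r` pays for an incomplete last cycle, since `N ≤ l * (N / l) + l`.
  refine ⟨a, haW, (3 * D 0 + 3 * D 0 / (1 - r)) / r, ?_, fun N => ?_⟩
  · have := hDn 0
    positivity
  · have hN : l * (N / l) + N % l = N := Nat.div_add_mod N l
    have h1 := hblock (N / l) (N % l) (Nat.mod_lt N hl).le
    have h2 := hdist (N / l)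
    rw [hN] at h1
    rw [dist_eq_norm] at h2
    have h3 := norm_sub_le_norm_sub_add_norm_sub (x N) (x (l * (N / l))) a
    have h4 : r * r ^ (N / l) ≤ ρ ^ N := by
      calc r * r ^ (N / l) = ρ ^ (l * (N / l) + l) := by
            rw [pow_add, pow_mul, hρl, mul_comm]
        _ ≤ ρ ^ N := pow_le_pow_of_le_one hρ0.le hρ1.le
            (by have := Nat.mod_lt N hl; omega)
    have h5 : 0 ≤ 3 * D 0 + 3 * D 0 / (1 - r) := by
      have := hDn 0
      positivity
    calc ‖x N - a‖ ≤ (3 * D 0 + 3 * D 0 / (1 - r)) * r ^ (N / l) := by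
          rw [add_mul, div_mul_eq_mul_div]
          linarith
      _ = (3 * D 0 + 3 * D 0 / (1 - r)) / r * (r * r ^ (N / l)) := by
          field_simp
      _ ≤ _ := mul_le_mul_of_nonneg_left h4 (div_nonneg h5 hr0.le)

lemma exists_rate_of_isQuasiFejerStep [ProperSpace X] {l : ℕ} (hl : 0 < l)
    {T : Fin l → X → Set X} {Z : Fin l → Set X} {w : X} {ν : ℝ} (hZc : ∀ j, IsClosed (Z j))
    (hw : w ∈ ⋂ j, Z j) (hν : 0 < ν) (hT : ∀ j, IsQuasiFejerStep (T j) (Z j) w ν)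
    (hreg : IsLinearlyRegularAround Z w) :
    ∃ δ > 0, ∃ ρ : ℝ, 0 ≤ ρ ∧ ρ < 1 ∧ ∀ x : ℕ → X, IsCyclicSequence T x →
      x 0 ∈ Metric.closedBall w δ → ∃ a ∈ ⋂ j, Z j, ConvergesRLinearly x a ρ := by
  have : Nonempty (Fin l) := ⟨⟨0, hl⟩⟩
  obtain ⟨δ₀, hδ₀, κ, hκ, hκreg⟩ := hreg
  set η := ν / (κ * (l + 1)) ^ 2 with hη
  have hη0 : 0 < η := by positivity
  -- The bound `3` gives `(1 + ε) ^ l ≤ 4`; the bound `η / 2` leaves a net factor of at most `1 - η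
  -- / 2` on the squared distance.
  obtain ⟨ε, hε, hεl⟩ := exists_pow_one_add_le l (lt_min (half_pos hη0) three_pos)
  choose δ hδ hstep using fun j => hT j ε hε
  obtain ⟨δ₁, hδ₁, hδ₁δ⟩ : ∃ δ₁ > 0, ∀ j, δ₁ ≤ δ j :=
    ⟨Finset.univ.inf' Finset.univ_nonempty δ, (Finset.lt_inf'_iff _).2 fun j _ => hδ j,
      fun j => Finset.inf'_le _ (Finset.mem_univ j)⟩
  -- `1 - η / 2` may be nonpositive, while the rate construction needs a positive factor.
  set q := max (1 / 4) (1 - η / 2) with hq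
  have hq0 : 0 < q := lt_max_of_lt_left (by norm_num)
  have hq1 : √q < 1 := by
    rw [Real.sqrt_lt' one_pos, one_pow]
    exact max_lt (by norm_num) (by linarith)
  have hWc : IsClosed (⋂ j, Z j) := isClosed_iInter hZc
  obtain ⟨δ', hδ', ρ, hρ0, hρ1, H⟩ := exists_convergesRLinearly (δ := min δ₀ (δ₁ / 4)) hl hWc hw
    (Real.sqrt_pos.2 hq0) hq1 (lt_min hδ₀ (by positivity))
  refine ⟨δ', hδ', ρ, hρ0, hρ1, fun x hx hx0 => H x (mem_closedBall_iff_norm.1 hx0) fun n hn => ?_⟩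
  have hcyc := cycle_estimate (l := l) (E := fun k => Z ⟨k % l, Nat.mod_lt k hl⟩)
    (y := fun k => x (l * n + k)) (δ := δ₁) (ε := ε) hWc hw
    (fun k _ => iInter_subset _ _) hν hκ hε.le
    (hεl.trans (by linarith [min_le_right (η / 2) 3]))
    (fun k hk hyk c hc hcw => by
      have hj : (⟨k % l, Nat.mod_lt k hl⟩ : Fin l) = ⟨k, hk⟩ := Fin.ext (Nat.mod_eq_of_lt hk)
      simp only [hj] at hc ⊢
      exact hstep ⟨k, hk⟩ _ (hyk.trans (hδ₁δ _)) _ (hx n ⟨k, hk⟩) c hc (hcw.trans (hδ₁δ _)))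
    (fun M hM => by
      refine (hκreg _ (mem_closedBall_iff_norm.2 (hn.trans (min_le_left _ _)))).trans
        (mul_le_mul_of_nonneg_left (ciSup_le fun j => ?_) hκ.le)
      have h := hM j j.2
      have hj : (⟨j % l, Nat.mod_lt j hl⟩ : Fin l) = j := Fin.ext (Nat.mod_eq_of_lt j.2)
      simpa only [hj, add_zero] using h)
    (by
      have := hn.trans (min_le_right _ _)
      rw [add_zero]
      linarith)
  simp only [add_zero] at hcyc
  refine ⟨hcyc.1, ?_⟩
  refine pow_le_pow_iff_left₀ Metric.infDist_nonneg
    (mul_nonneg (Real.sqrt_nonneg _) Metric.infDist_nonneg) two_ne_zero |>.1 ?_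
  rw [mul_pow, Real.sq_sqrt hq0.le]
  refine hcyc.2.trans (mul_le_mul_of_nonneg_right ?_ (sq_nonneg _))
  refine le_trans ?_ (le_max_right _ _)
  linarith [min_le_left (η / 2) 3]

end Cycles

/-! ### Propagation of the common projection along the graph. -/

section Connected

variable {X : Type*} [NormedAddCommGroup X]

/-- If along each edge of a connected graph the projections of `a` are a common singleton, then
all projections of `a` are the same singleton. -/
lemma exists_projector_eq_singleton_of_connected {m l : ℕ} {C : Fin m → Set X}
    {s t : Fin l → Fin m} {a : X} (hcover : range s ∪ range t = univ)
    (h : ∀ j, ∃ c, projector (C (s j)) a = {c} ∧ projector (C (t j)) a = {c})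
    (hconn : (pairGraph s t).Connected) :
    ∃ p ∈ ⋂ i, C i, ∀ i, projector (C i) a = {p} := by
  obtain ⟨i₀⟩ := hconn.nonempty
  obtain ⟨p, hp⟩ : ∃ p, projector (C i₀) a = {p} := by
    have hi : i₀ ∈ range s ∪ range t := hcover ▸ mem_univ i₀
    rcases hi with ⟨j, rfl⟩ | ⟨j, rfl⟩
    · exact (h j).imp fun _ hc => hc.1
    · exact (h j).imp fun _ hc => hc.2
  have hedge (j : Fin l) : projector (C (s j)) a = projector (C (t j)) a := by
    obtain ⟨c, h1, h2⟩ := h j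
    rw [h1, h2]
  have hadj {i k : Fin m} (hik : (pairGraph s t).Adj i k) :
      projector (C i) a = projector (C k) a := by
    rw [pairGraph, SimpleGraph.fromRel_adj] at hik
    rcases hik with ⟨-, ⟨j, rfl, rfl⟩ | ⟨j, rfl, rfl⟩⟩
    · exact hedge j
    · exact (hedge j).symm
  have hwalk {i k : Fin m} (W : (pairGraph s t).Walk i k) :
      projector (C i) a = projector (C k) a := by
    induction W with
    | nil => rfl
    | cons hik _ ih => exact (hadj hik).trans ih
  have hall (i : Fin m) : projector (C i) a = {p} := by
    obtain ⟨W⟩ := hconn.preconnected i i₀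
    exact (hwalk W).trans hp
  refine ⟨p, mem_iInter.2 fun i => ?_, hall⟩
  have hpi : p ∈ projector (C i) a := by
    rw [hall i]
    rfl
  exact hpi.1

end Connected

end CyclicGDR

/-! ### Assembly, with the smallest of the constants `ν j`. -/

theorem theorem5p9 {X : Type*} [NormedAddCommGroup X] [InnerProductSpace ℝ X]
    [FiniteDimensional ℝ X] {m l : ℕ} (hl : 0 < l)
    (C : Fin m → Set X) (hC : ∀ i, IsClosed (C i))
    (lam mu al : Fin l → ℝ)
    (hlam : ∀ j, lam j ∈ Set.Ioc (0 : ℝ) 2) (hmu : ∀ j, mu j ∈ Set.Ioc (0 : ℝ) 2)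
    (hal : ∀ j, al j ∈ Set.Ioo (0 : ℝ) (1 + CyclicGDR.betaHat (lam j) (mu j)))
    (s t : Fin l → Fin m) (hst : ∀ j, s j ≠ t j)
    (hcover : Set.range s ∪ Set.range t = Set.univ)
    (T : Fin l → X → Set X)
    (hT : ∀ j, T j = CyclicGDR.gdrOperator (C (s j)) (C (t j)) (lam j) (mu j) (al j))
    (Z : Fin l → Set X)
    (hZ : ∀ j, Z j = CyclicGDR.gdrSet (C (s j)) (C (t j)) (lam j) (mu j))
    (w : X) (hw : w ∈ ⋂ i, C i)
    (hZreg : CyclicGDR.IsLinearlyRegularAround Z w)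
    (hsuper : ∀ i, CyclicGDR.IsSuperregularAt (C i) w)
    (hlin : ∀ j, min (lam j) (mu j) < 2 →
      CyclicGDR.IsLinearlyRegularAround ![C (s j), C (t j)] w)
    (haff : ∀ j, ¬ min (lam j) (mu j) < 2 →
      CyclicGDR.IsAffineHullRegularAt ![C (s j), C (t j)] w) :
    (⋂ j, Z j) ⊆ (⋂ j, CyclicGDR.fixedPoints (T j)) ∧
    ∃ δ > 0, ∃ ρ : ℝ, 0 ≤ ρ ∧ ρ < 1 ∧
      ∀ x : ℕ → X, CyclicGDR.IsCyclicSequence T x → x 0 ∈ Metric.closedBall w δ →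
        ∃ a ∈ ⋂ j, Z j, CyclicGDR.ConvergesRLinearly x a ρ ∧
          ((CyclicGDR.pairGraph s t).Connected →
            ∃ p ∈ ⋂ i, C i, ∀ i, CyclicGDR.projector (C i) a = {p}) := by
  have : ProperSpace X := FiniteDimensional.proper ℝ X
  have hwC (i : Fin m) : w ∈ C i := Set.mem_iInter.1 hw i
  have hwZ : w ∈ ⋂ j, Z j := Set.mem_iInter.2 fun j => by
    rw [hZ]
    exact CyclicGDR.inter_subset_gdrSet _ _ _ _ ⟨hwC _, hwC _⟩
  have hZc (j : Fin l) : IsClosed (Z j) := by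
    rw [hZ]
    exact CyclicGDR.isClosed_gdrSet (hC _) (hC _) _ _
  have : Nonempty (Fin l) := ⟨⟨0, hl⟩⟩
  choose ν hν hstep using fun j => CyclicGDR.exists_isQuasiFejerStep_gdr (hlam j) (hmu j) (hal j)
    (hC _) (hC _) (hsuper _) (hsuper _) (hwC _) (hwC _) (hlin j) (haff j)
  obtain ⟨δ, hδ, ρ, hρ0, hρ1, H⟩ := CyclicGDR.exists_rate_of_isQuasiFejerStep (T := T)
    (ν := Finset.univ.inf' Finset.univ_nonempty ν) hl hZc hwZ
    ((Finset.lt_inf'_iff _).2 fun j _ => hν j)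
    (fun j => by
      rw [hT, hZ]
      exact (hstep j).mono (Finset.inf'_le _ (Finset.mem_univ j))) hZreg
  refine ⟨Set.iInter_mono fun j => ?_, δ, hδ, ρ, hρ0, hρ1, fun x hx hx0 => ?_⟩
  · rw [hT, hZ]
    exact CyclicGDR.gdrSet_subset_fixedPoints _ _ _ _ _
  · obtain ⟨a, ha, hxa⟩ := H x hx hx0
    refine ⟨a, ha, hxa, CyclicGDR.exists_projector_eq_singleton_of_connected hcover fun j => ?_⟩
    have haj := Set.mem_iInter.1 ha j
    rw [hZ] at haj
    obtain ⟨c, -, hc⟩ := CyclicGDR.exists_projector_eq_singleton_of_mem_gdrSet haj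
    exact ⟨c, hc⟩
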